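/- **Proposition ($m$ out of $n$ bootstrap).** Let $\mathbb P=\mathbb Q=N(\mu,\Sigma)$ on $\mathbb R^d$ with $\Sigma$ symmetric positive definite, and let $X_1,X_2,\dots$ be i.i.d. with law $\mathbb P$. For points $x_1,\dots,x_k\in\mathbb R^d$ put $\hat\mu=\frac1k\sum_{i}x_i$, $\hat\Sigma=\frac1{k-1}\sum_{i}(x_i-\hat\mu)(x_i-\hat\mu)^t$ and $$\widehat{\mathcal{GW}}(x_1,\dots,x_k)=\mathcal W_2^2\big(N(\hat\mu,\hat\Sigma),\mathbb Q\big),$$ where $\mathcal W_2$ is the $2$-Wasserstein distance, $\mathcal W_2^2(P,Q)=\inf_\pi\int\|x-y\|^2\,\pi(dx,dy)$ over all couplings $\pi$ of $P$ and $Q$. Let $\widehat{\mathcal{GW}}_n=\widehat{\mathcal{GW}}(X_1,\dots,X_n)$ and $\widehat{\mathcal{GW}}{}^*_m=\widehat{\mathcal{GW}}(X_1^*,\dots,X_m^*)$, where, given the data, $X_1^*,\dots,X_m^*$ are drawn independently and uniformly, with replacement, from $X_1,\dots,X_n$. Let $\Phi(a,A)=\|a-\mu\|^2+\operatorname{tr}A+\operatorname{tr}\Sigma-2\operatorname{tr}\big[(A^{1/2}\Sigma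 A^{1/2})^{1/2}\big]$ for $a\in\mathbb R^d$ and $A$ in the (open) set of positive definite matrices in the space of symmetric $d\times d$ matrices. Then $\Phi$ is twice Fréchet differentiable at $(\mu,\Sigma)$; let $$Z_1=\tfrac12\,D^2_{(\mu,\Sigma)}\Phi\big[(g,G),(g,G)\big],\qquad G=\Sigma^{1/2}H\Sigma^{1/2},$$ where $g\sim N(0,\Sigma)$ is independent of the symmetric random matrix $H$, whose entries $H_{ij}$, $i\le j$, are independent with $H_{ij}\sim N(0,1)$ for $i<j$ and $H_{ii}\sim N(0,2)$. If $m=m(n)\to\infty$ and $m(n)/n\to0$ as $n\to\infty$, then $$m\big(\widehat{\mathcal{GW}}{}^*_m-\widehat{\mathcal{GW}}_n\big)\Rightarrow Z_1\quad\text{conditionally given }X_1,X_2,\dots\text{ in probability},$$ that is, $\rho\big(\mathcal L(m(\widehat{\mathcal{GW}}{}^*_m-\widehat{\mathcal{GW}}_n)\mid X_1,\dots,X_n),\mathcal L(Z_1)\big)\to0$ in probability as $n\to\infty$, where $\rho$ is the Lévy–Prokhorov metric, which metrizes weak convergence of probability measures on $\mathbb R$. -/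

import Mathlib

open MeasureTheory ProbabilityTheory Filter Topology Matrix
open scoped MatrixOrder ENNReal NNReal

namespace GaussWass

/-- The Euclidean space of dimension `d`, and the real `d × d` matrices. -/
abbrev Vec (d : ℕ) := EuclideanSpace ℝ (Fin d)
abbrev Mat (d : ℕ) := Matrix (Fin d) (Fin d) ℝ

/-! ### The Wasserstein distance -/

/-- The couplings of `P` and `Q`: the measures on the product space with marginals `P` and `Q`. -/
def couplings {d : ℕ} (P Q : Measure (Vec d)) : Set (Measure (Vec d × Vec d)) :=
  {π | π.map Prod.fst = P ∧ π.map Prod.snd = Q}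

/-- The `p`-Wasserstein distance. -/
noncomputable def wasserstein {d : ℕ} (p : ℝ) (P Q : Measure (Vec d)) : ℝ :=
  (⨅ π ∈ couplings P Q, (∫⁻ z, ENNReal.ofReal (‖z.1 - z.2‖ ^ p) ∂π) ^ (1 / p)).toReal

/-! ### Empirical mean and covariance, the Gaussian Wasserstein estimator -/

noncomputable def sampleMean {d n : ℕ} (x : Fin n → Vec d) : Vec d :=
  (n : ℝ)⁻¹ • ∑ i, x i

noncomputable def sampleCov {d n : ℕ} (x : Fin n → Vec d) : Mat d :=
  ((n : ℝ) - 1)⁻¹ • ∑ i, Matrix.of fun k l => (x i - sampleMean x) k * (x i - sampleMean x) l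

/-- The one-sample Gaussian Wasserstein estimator: the squared `2`-Wasserstein distance between
the Gaussian law with the empirical mean and covariance of `x` and the law `Q`. -/
noncomputable def gwEstimator {d n : ℕ} (x : Fin n → Vec d) (Q : Measure (Vec d)) : ℝ :=
  wasserstein 2 (multivariateGaussian (sampleMean x) (sampleCov x)) Q ^ 2

/-- The conditional law, given the sample `x` of size `n`, of `m (GW*_m - GW_n)`: the resample
`x ∘ J` is drawn with replacement, `J 0, …, J (m - 1)` being independent and uniform on the
`n` indices. -/
noncomputable def bootstrapLaw {d n : ℕ} (x : Fin n → Vec d) (Q : Measure (Vec d)) (m : ℕ) :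
    Measure ℝ :=
  (Measure.pi fun _ : Fin m => uniformOn (Set.univ : Set (Fin n))).map
    fun J => (m : ℝ) * (gwEstimator (fun k => x (J k)) Q - gwEstimator x Q)

/-! ### The functional `Φ` and the limit law -/

/-- `‖μ - ν‖² + tr A + tr B - 2 tr (A^{1/2} B A^{1/2})^{1/2}`. -/
noncomputable def Phi {d : ℕ} (μ ν : Vec d) (A B : Mat d) : ℝ :=
  ‖μ - ν‖ ^ 2 + A.trace + B.trace - 2 * (CFC.sqrt (CFC.sqrt A * B * CFC.sqrt A)).trace

/-- The real vector space of symmetric matrices. -/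
abbrev SymMat (d : ℕ) := selfAdjoint.submodule ℝ (Mat d)

/-- `Φ` as a functional of mean and covariance, for fixed `ν`, `B`. The positive definite matrices
are open in `SymMat d`, so values elsewhere do not affect derivatives at a positive definite
matrix. -/
noncomputable def PhiOne {d : ℕ} (ν : Vec d) (B : Mat d) (p : Vec d × SymMat d) : ℝ :=
  Phi p.1 ν (p.2 : Mat d) B

/-- The symmetric matrix with upper triangle (diagonal included) taken from `w`. -/
def symOf {d : ℕ} (w : Fin d × Fin d → ℝ) : Mat d :=
  Matrix.of fun i j => w (min i j, max i j)

theorem isSelfAdjoint_symOf {d : ℕ} (w : Fin d × Fin d → ℝ) : IsSelfAdjoint (symOf w) := by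
  ext i j
  simp [symOf, Matrix.star_apply, min_comm, max_comm]

/-- The symmetric matrix `S^{1/2} H S^{1/2}`, where `H = symOf w`. -/
noncomputable def rootConj {d : ℕ} (S : Mat d) (w : Fin d × Fin d → ℝ) : SymMat d :=
  ⟨CFC.sqrt S * symOf w * CFC.sqrt S, by
    have h : IsSelfAdjoint (CFC.sqrt S) := (CFC.sqrt_nonneg S).isSelfAdjoint
    have h2 := (isSelfAdjoint_symOf w).conjugate (CFC.sqrt S)
    rw [h.star_eq] at h2
    exact h2⟩

/-- Joint law of `(g, w)`: `g ∼ N(0, S)` is independent of `w`, whose entries are independent and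
centred normal, with variance `2` on the diagonal and `1` off the diagonal. -/
noncomputable def noiseLaw {d : ℕ} (S : Mat d) : Measure (Vec d × (Fin d × Fin d → ℝ)) :=
  (multivariateGaussian 0 S).prod
    (Measure.pi fun ij : Fin d × Fin d => gaussianReal 0 (if ij.1 = ij.2 then 2 else 1))

open scoped Matrix.Norms.L2Operator

/-- Twofold Fréchet differentiability at a point. -/
def TwiceDifferentiableAt {E : Type*} [NormedAddCommGroup E] [NormedSpace ℝ E] (f : E → ℝ)
    (a : E) : Prop :=
  (∀ᶠ y in 𝓝 a, DifferentiableAt ℝ f y) ∧ DifferentiableAt ℝ (fderiv ℝ f) a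

/-- `Φ^{(ν,B)}` is twice Fréchet differentiable at `(μ, S)` (operator norm on matrices). -/
def PhiOneTwiceDifferentiableAt {d : ℕ} (ν : Vec d) (B : Mat d) (μ : Vec d) (S : SymMat d) :
    Prop :=
  TwiceDifferentiableAt (PhiOne ν B) (μ, S)

/-- The quadratic form `h ↦ D²Φ^{(ν,B)}[h, h]` of the second Fréchet derivative at `(μ, S)`. -/
noncomputable def D2PhiOne {d : ℕ} (ν : Vec d) (B : Mat d) (μ : Vec d) (S : SymMat d)
    (h : Vec d × SymMat d) : ℝ :=
  fderiv ℝ (fderiv ℝ (PhiOne ν B)) (μ, S) h h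

/-- The law of `Z₁ = ½ D²Φ^{(μ,S)}[(g, G), (g, G)]`, derivative at `(μ, S)`, where
`g ∼ N(0, S)` and `G = S^{1/2} H S^{1/2}`. -/
noncomputable def limitLaw {d : ℕ} (μ : Vec d) (S : SymMat d) : Measure ℝ :=
  (noiseLaw (S : Mat d)).map fun gw =>
    1 / 2 * D2PhiOne μ (S : Mat d) μ S (gw.1, rootConj (S : Mat d) gw.2)

end GaussWass

/-! Since the sampling law is the target law, the squared distance to `N(μ, S)`, as a function of
mean and covariance, is nonnegative and vanishes at `(μ, S)`. Gelbrich's formula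
(`wasserstein_two_sq_multivariateGaussian`) identifies it near that point with `Φ`, which is C²
because the matrix square root is smooth near a positive definite matrix. So the first derivative
vanishes at `(μ, S)`, and `½ D²Φ` governs the squared distance to second order (`isLittleO_gwAt`): a
displacement of order `m^{-1/2}`, multiplied by `m`, leaves the quadratic form evaluated at the
scaled displacement.

Mean and covariance of any sample are an explicit function of the average of `stat`, that is of `(y,
y yᵗ - S)` with `y = x - μ`. Given the data, `√m` times this average over the resample is a
normalised sum of i.i.d. terms. Its characteristic function converges to that of `(g, G)` as soon as
the data satisfy three conditions: `√m` times the data average of `stat` tends to `0`, the second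
moments tend to `statCov`, and the third absolute moments converge (`tendsto_charFun_map_resample`).
The identification of the limit rests on Isserlis' theorem: `stat` and `(g, G)` have the same
covariance.

The first condition is where `m = o(n)` is essential: that average has variance of order `m / n`. It
makes centring at the true parameters harmless and forces `m` times the estimator of the full sample
to `0`, so that only the resampled term survives. An extended continuous mapping theorem then
transfers the convergence to the estimator.

All this is proved for deterministic samples. A contradiction argument
(`exists_levyProkhorovDist_bootstrapLaw_lt`) turns it into a uniform statement: if finitely many
empirical averages are within `δ` of their limits, then the Lévy–Prokhorov distance is below `ε`.
Chebyshev's inequality and the law of large numbers bound the probability of the complement. -/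

namespace GaussWass

open scoped Matrix.Norms.L2Operator

/-! ### Smoothness of the matrix square root -/

section SquareRoot

variable {d : ℕ}

/-- Multiplying by `Hᴴ` and taking traces splits zero into the traces of two positive semidefinite
matrices, so `Hᴴ Q H = 0`, and definiteness of `Q` kills every column of `H`. This is injectivity of
the derivative of squaring, as the inverse function theorem requires. -/
theorem eq_zero_of_mul_add_mul_eq_zero {Q : Mat d} (hQ : Q.PosDef) {H : Mat d}
    (h : Q * H + H * Q = 0) : H = 0 := by
  have h1 : (Hᴴ * Q * H).PosSemidef := hQ.posSemidef.conjTranspose_mul_mul_same H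
  have h2 : (H * Q * Hᴴ).PosSemidef := hQ.posSemidef.mul_mul_conjTranspose_same H
  have h3 : (Hᴴ * Q * H).trace + (H * Q * Hᴴ).trace = 0 := by
    have := congrArg (fun M => (Hᴴ * M).trace) h
    simp only [mul_add, mul_zero, trace_add, trace_zero] at this
    rw [← this, Matrix.trace_mul_comm (H * Q), Matrix.mul_assoc]
  have h4 : (Hᴴ * Q * H).trace = 0 := by
    have := h1.trace_nonneg; have := h2.trace_nonneg; linarith
  rw [h1.trace_eq_zero_iff] at h4
  ext i j
  by_contra hij
  have hx : H *ᵥ Pi.single j 1 ≠ 0 := by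
    intro h0
    apply hij
    have := congrFun h0 i
    simpa using this
  have := hQ.dotProduct_mulVec_pos hx
  have h5 : star (H *ᵥ Pi.single j 1) ⬝ᵥ Q *ᵥ (H *ᵥ Pi.single j 1)
      = star (Pi.single j 1) ⬝ᵥ (Hᴴ * Q * H) *ᵥ (Pi.single j 1 : Fin d → ℝ) := by
    rw [star_mulVec, ← dotProduct_mulVec, mulVec_mulVec, mulVec_mulVec, Matrix.mul_assoc]
  rw [h5, h4] at this
  simp at this

/-- The derivative of `Q ↦ Q * Q`. -/
noncomputable def anticommCLM (Q : Mat d) : Mat d →L[ℝ] Mat d :=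
  ContinuousLinearMap.mul ℝ (Mat d) Q + (ContinuousLinearMap.mul ℝ (Mat d)).flip Q

theorem hasFDerivAt_mul_self (Q : Mat d) :
    HasFDerivAt (fun M : Mat d => M * M) (anticommCLM Q) Q := by
  have := (hasFDerivAt_id (𝕜 := ℝ) Q).mul' (hasFDerivAt_id (𝕜 := ℝ) Q)
  convert! this using 1

theorem exists_anticommEquiv {Q : Mat d} (hQ : Q.PosDef) :
    ∃ e : Mat d ≃L[ℝ] Mat d, (e : Mat d →L[ℝ] Mat d) = anticommCLM Q := by
  have hinj : Function.Injective (anticommCLM Q : Mat d →ₗ[ℝ] Mat d) := by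
    rw [injective_iff_map_eq_zero]
    intro H hH
    exact eq_zero_of_mul_add_mul_eq_zero hQ (by simpa [anticommCLM] using hH)
  refine ⟨(LinearEquiv.ofInjectiveEndo _ hinj).toContinuousLinearEquiv, ?_⟩
  ext M : 1
  rfl

theorem posDef_sqrt {A : Mat d} (hA : A.PosDef) : (CFC.sqrt A).PosDef := by
  have h := (CFC.sqrt_nonneg A).posSemidef
  rw [h.posDef_iff_isUnit]
  have h1 : CFC.sqrt A * CFC.sqrt A = A := CFC.sqrt_mul_sqrt_self A hA.posSemidef.nonneg
  have h2 := hA.isUnit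
  rw [Matrix.isUnit_iff_isUnit_det] at h2 ⊢
  rw [← h1, Matrix.det_mul] at h2
  exact isUnit_of_mul_isUnit_left h2

theorem continuousAt_conjTranspose (A : Mat d) : ContinuousAt (fun M : Mat d => Mᴴ) A :=
  (continuous_id.matrix_conjTranspose).continuousAt

/-- A smooth local right inverse of squaring, preserving Hermitian matrices. -/
theorem exists_local_sqrt {A : Mat d} (hA : A.PosDef) :
    ∃ g : Mat d → Mat d, ContDiffAt ℝ 2 g A ∧ g A = CFC.sqrt A ∧
      (∀ᶠ M in 𝓝 A, g M * g M = M) ∧ ∀ᶠ M in 𝓝 A, M.IsHermitian → (g M).IsHermitian := by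
  set Q := CFC.sqrt A with hQdef
  have hQ : Q.PosDef := posDef_sqrt hA
  have hQA : Q * Q = A := CFC.sqrt_mul_sqrt_self A hA.posSemidef.nonneg
  obtain ⟨e, he⟩ := exists_anticommEquiv hQ
  have hc : ContDiffAt ℝ 2 (fun M : Mat d => M * M) Q := contDiffAt_id.mul contDiffAt_id
  have hd : HasFDerivAt (fun M : Mat d => M * M) (e : Mat d →L[ℝ] Mat d) Q :=
    he ▸ hasFDerivAt_mul_self Q
  have hs := hc.hasStrictFDerivAt' hd two_ne_zero
  have hleft := hs.eventually_left_inverse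
  have hright := hs.eventually_right_inverse
  have htend := hs.localInverse_tendsto
  have hcd := hc.to_localInverse hd two_ne_zero
  have hval := hc.localInverse_apply_image hd two_ne_zero
  change ContDiffAt ℝ 2 (hs.localInverse _ _ _) _ at hcd
  change hs.localInverse _ _ _ _ = Q at hval
  beta_reduce at hcd hval hright htend
  rw [hQA] at hcd hval hright htend
  refine ⟨_, hcd, hval, hright, ?_⟩
  -- For Hermitian `M` the adjoint of the local root is again a root of `M` close to `Q`; local
  -- injectivity of squaring makes the two equal.
  have htend' : Tendsto (fun M => (hs.localInverse _ _ _ M)ᴴ) (𝓝 A) (𝓝 Q) := by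
    have := (continuousAt_conjTranspose Q).tendsto.comp htend
    rwa [hQ.isHermitian.eq] at this
  filter_upwards [hright, htend.eventually hleft, htend'.eventually hleft] with M h1 h2 h3 hM
  have h4 : (hs.localInverse _ _ _ M)ᴴ * (hs.localInverse _ _ _ M)ᴴ = M := by
    rw [← conjTranspose_mul, h1, hM.eq]
  rw [h4] at h3
  exact h3.symm

/-- A Hermitian `M` near `A` is the square of its Hermitian local root, hence positive semidefinite,
and invertibility is an open condition. -/
theorem eventually_posDef {A : Mat d} (hA : A.PosDef) :
    ∀ᶠ M in 𝓝 A, M.IsHermitian → M.PosDef := by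
  obtain ⟨g, -, -, h1, h2⟩ := exists_local_sqrt hA
  have hu : ∀ᶠ M in 𝓝 A, IsUnit M := by
    obtain ⟨u, hu⟩ := hA.isUnit
    exact hu ▸ (Units.isOpen.mem_nhds u.isUnit)
  filter_upwards [h1, h2, hu] with M h1 h2 h3 hM
  have : M.PosSemidef := by
    have := posSemidef_conjTranspose_mul_self (g M)
    rwa [(h2 hM).eq, h1] at this
  exact this.posDef_iff_isUnit.2 h3

/-- The local root stays near the positive definite `CFC.sqrt A`, so it is nonnegative on Hermitian
matrices and uniqueness of the nonnegative root applies. Agreement is claimed only there, which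
suffices because `PhiOne` lives on `SymMat`. -/
theorem exists_contDiffAt_sqrt {A : Mat d} (hA : A.PosDef) :
    ∃ g : Mat d → Mat d, ContDiffAt ℝ 2 g A ∧ g A = CFC.sqrt A ∧
      ∀ᶠ M in 𝓝 A, M.IsHermitian → CFC.sqrt M = g M := by
  obtain ⟨g, hc, h0, h1, h2⟩ := exists_local_sqrt hA
  refine ⟨g, hc, h0, ?_⟩
  have h3 := hc.continuousAt.eventually (h0 ▸ eventually_posDef (posDef_sqrt hA))
  filter_upwards [h1, h2, h3] with M h1 h2 h3 hM
  exact CFC.sqrt_unique h1 (h3 (h2 hM)).posSemidef.nonneg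

end SquareRoot

/-! ### Smoothness of `Φ` -/

section Smooth

variable {d : ℕ}

theorem SymMat.isHermitian (A : SymMat d) : (A : Mat d).IsHermitian := A.2

theorem posDef_sqrt_mul_mul_sqrt {A B : Mat d} (hA : A.PosDef) (hB : B.PosDef) :
    (CFC.sqrt A * B * CFC.sqrt A).PosDef := by
  have hR := posDef_sqrt hA
  have := (Matrix.IsUnit.posDef_star_right_conjugate_iff (x := B) hR.isUnit).2 hB
  rwa [star_eq_conjTranspose, hR.isHermitian.eq] at this

theorem contDiffAt_phiOne (ν : Vec d) {B : Mat d} (hB : B.PosDef) (μ : Vec d) (S : SymMat d)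
    (hS : (S : Mat d).PosDef) : ContDiffAt ℝ 2 (PhiOne ν B) (μ, S) := by
  obtain ⟨g, hg, hg0, hgs⟩ := exists_contDiffAt_sqrt hS
  obtain ⟨k, hk, hk0, hks⟩ := exists_contDiffAt_sqrt (posDef_sqrt_mul_mul_sqrt hS hB)
  have hval : ContDiffAt ℝ 2 (fun p : Vec d × SymMat d => (p.2 : Mat d)) (μ, S) :=
    ((SymMat d).subtypeL.comp (ContinuousLinearMap.snd ℝ (Vec d) (SymMat d))).contDiff.contDiffAt
  have hgv : ContDiffAt ℝ 2 (fun p : Vec d × SymMat d => g (p.2 : Mat d)) (μ, S) :=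
    ContDiffAt.comp (μ, S) (g := g) hg hval
  have hinner : ContDiffAt ℝ 2 (fun p : Vec d × SymMat d => g (p.2 : Mat d) * B * g (p.2 : Mat d))
      (μ, S) := (hgv.mul contDiffAt_const).mul hgv
  have hkv : ContDiffAt ℝ 2
      (fun p : Vec d × SymMat d => k (g (p.2 : Mat d) * B * g (p.2 : Mat d))) (μ, S) :=
    ContDiffAt.comp (μ, S) (g := k) (by simpa only [hg0] using hk) hinner
  let tr : Mat d →L[ℝ] ℝ := LinearMap.toContinuousLinearMap (Matrix.traceLinearMap (Fin d) ℝ ℝ)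
  have htr : ∀ f : Vec d × SymMat d → Mat d, ContDiffAt ℝ 2 f (μ, S) →
      ContDiffAt ℝ 2 (fun p => (f p).trace) (μ, S) := fun f hf =>
    (tr.contDiff.contDiffAt).comp (μ, S) hf
  have hmain : ContDiffAt ℝ 2 (fun p : Vec d × SymMat d =>
      ‖p.1 - ν‖ ^ 2 + (p.2 : Mat d).trace + B.trace
        - 2 * (k (g (p.2 : Mat d) * B * g (p.2 : Mat d))).trace) (μ, S) := by
    refine ContDiffAt.sub (ContDiffAt.add (ContDiffAt.add ?_ (htr _ hval)) contDiffAt_const)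
      (contDiffAt_const.mul (htr _ hkv))
    exact (contDiffAt_fst.sub contDiffAt_const).norm_sq ℝ
  refine hmain.congr_of_eventuallyEq ?_
  have e1 := hval.continuousAt.eventually hgs
  have e2 := hinner.continuousAt.eventually (by simpa only [hg0] using hks)
  filter_upwards [e1, e2, hval.continuousAt.eventually (eventually_posDef hS)] with p h1 h2 h3
  simp only [PhiOne, Phi]
  have hp := SymMat.isHermitian p.2
  rw [h1 hp, h2]
  rw [← h1 hp]
  exact (posDef_sqrt_mul_mul_sqrt (h3 hp) hB).isHermitian

theorem twiceDifferentiableAt_of_contDiffAt {E : Type*} [NormedAddCommGroup E] [NormedSpace ℝ E]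
    {f : E → ℝ} {a : E} (h : ContDiffAt ℝ 2 f a) : TwiceDifferentiableAt f a := by
  refine ⟨?_, ?_⟩
  · filter_upwards [h.eventually (by simp)] with y hy
    exact hy.differentiableAt two_ne_zero
  · exact (h.fderiv_right (m := 1) (by norm_num)).differentiableAt one_ne_zero

/-- Second order Taylor expansion at a critical point. -/
theorem isLittleO_sub_half_fderiv_fderiv {E : Type*} [NormedAddCommGroup E] [NormedSpace ℝ E]
    {f : E → ℝ} {a : E} (h : ContDiffAt ℝ 2 f a) (h1 : fderiv ℝ f a = 0) :
    (fun x => f (a + x) - f a - 1 / 2 * fderiv ℝ (fderiv ℝ f) a x x)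
      =o[𝓝 0] fun x => ‖x‖ ^ 2 := by
  set D := fderiv ℝ (fderiv ℝ f) a with hD
  have hsymm : ∀ x y, D x y = D y x := fun x y =>
    (h.isSymmSndFDerivAt (by simp)) x y
  have hdiff := twiceDifferentiableAt_of_contDiffAt h
  have hlo := hdiff.2.hasFDerivAt.isLittleO
  rw [Asymptotics.isLittleO_iff]
  intro c hc
  rw [Asymptotics.isLittleO_iff] at hlo
  have ev := (hdiff.1).and (hlo hc)
  rw [Metric.eventually_nhds_iff_ball] at ev
  obtain ⟨r, hr, hball⟩ := ev
  rw [Metric.eventually_nhds_iff_ball]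
  refine ⟨r, hr, fun x hx => ?_⟩
  -- Mean value inequality for the remainder on the ball of radius `‖x‖`. By symmetry of `D` its
  -- derivative is `fderiv ℝ f (a + y) - D y`, which is `o(‖y‖)` because `a` is critical.
  have hder : ∀ y ∈ Metric.closedBall (0 : E) ‖x‖, HasFDerivWithinAt
      (fun x => f (a + x) - f a - 1 / 2 * D x x) (fderiv ℝ f (a + y) - D y)
      (Metric.closedBall (0 : E) ‖x‖) y := by
    intro y hy
    have hy' : a + y ∈ Metric.ball a r := by
      simp only [Metric.mem_ball, dist_self_add_left, mem_closedBall_zero_iff, dist_zero_right] at *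
      linarith
    have hf : HasFDerivAt (fun x => f (a + x)) (fderiv ℝ f (a + y)) y := by
      have := (hball _ hy').1.hasFDerivAt
      exact (hasFDerivAt_comp_add_left a).2 this
    have hq : HasFDerivAt (fun x => D x x) (D y + D.flip y) y := by
      have := (D.hasFDerivAt (x := y)).clm_apply (hasFDerivAt_id y)
      convert! this using 1
    refine HasFDerivAt.hasFDerivWithinAt ?_
    convert! (hf.sub_const (f a)).sub (hq.const_mul (1 / 2)) using 1
    ext z
    simp [hsymm z y]
    ring
  have hbound : ∀ y ∈ Metric.closedBall (0 : E) ‖x‖, ‖fderiv ℝ f (a + y) - D y‖ ≤ c * ‖x‖ := by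
    intro y hy
    have hy' : a + y ∈ Metric.ball a r := by
      simp only [Metric.mem_ball, dist_self_add_left, mem_closedBall_zero_iff, dist_zero_right] at *
      linarith
    have := (hball _ hy').2
    rw [h1] at this
    simp only [sub_zero, add_sub_cancel_left] at this
    refine this.trans ?_
    gcongr
    simpa using hy
  have := (convex_closedBall (0 : E) ‖x‖).norm_image_sub_le_of_norm_hasFDerivWithin_le hder hbound
    (Metric.mem_closedBall_self (norm_nonneg x)) (y := x) (by simp)
  simpa [pow_two, mul_assoc] using this

end Smooth

end GaussWass

namespace GaussWass

/-! ### The Gaussian Wasserstein formula -/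

section Gelbrich

open scoped RealInnerProductSpace

variable {d : ℕ}

/-- The continuous linear map of a matrix. -/
noncomputable abbrev clm (T : Mat d) : Vec d →L[ℝ] Vec d := toEuclideanCLM (𝕜 := ℝ) T

/-! ### Integrals of quadratic polynomials under Gaussian laws. -/

theorem memLp_eval_gaussian (ν : Measure (Vec d)) [IsGaussian ν] (i : Fin d) (p : ℝ≥0∞)
    (hp : p ≠ ∞) : MemLp (fun x : Vec d => x i) p ν :=
  (IsGaussian.memLp_id ν p hp).eval_piLp i

theorem integral_eval_multivariateGaussian (a : Vec d) (A : Mat d) (i : Fin d) :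
    ∫ x, x i ∂(multivariateGaussian a A) = a i := by
  have := (EuclideanSpace.proj (𝕜 := ℝ) i).integral_comp_comm
    (μ := multivariateGaussian a A) IsGaussian.integrable_fun_id
  simpa using this

theorem memLp_eval_sub_gaussian (ν : Measure (Vec d)) [IsGaussian ν] (a : Vec d) (i : Fin d)
    (p : ℝ≥0∞) (hp : p ≠ ∞) : MemLp (fun x : Vec d => (x - a) i) p ν :=
  (memLp_eval_gaussian ν i p hp).sub (memLp_const (a i))

theorem integral_eval_sub_mul_eval_sub {a : Vec d} {A : Mat d} (hA : A.PosSemidef) (i j : Fin d) :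
    ∫ x, (x - a) i * (x - a) j ∂(multivariateGaussian a A) = A i j := by
  rw [← covariance_eval_multivariateGaussian (μ := a) hA i j, covariance]
  simp only [integral_eval_multivariateGaussian]
  rfl

theorem inner_clm_self (N : Mat d) (w : Vec d) :
    ⟪w, clm N w⟫ = ∑ i, ∑ j, N i j * (w i * w j) := by
  rw [inner_toEuclideanCLM]
  simp only [dotProduct, mulVec, Finset.mul_sum]
  exact Finset.sum_congr rfl fun i _ => Finset.sum_congr rfl fun j _ => by ring

theorem integrable_eval_sub_mul_eval_sub (ν : Measure (Vec d)) [IsGaussian ν] (a : Vec d)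
    (i j : Fin d) : Integrable (fun x : Vec d => (x - a) i * (x - a) j) ν :=
  (memLp_eval_sub_gaussian ν a i 2 (by simp)).integrable_mul
    (memLp_eval_sub_gaussian ν a j 2 (by simp))

theorem integrable_quadratic (ν : Measure (Vec d)) [IsGaussian ν] (a e : Vec d) (c : ℝ)
    (N : Mat d) : Integrable (fun x => c + ⟪e, x - a⟫ + ⟪x - a, clm N (x - a)⟫) ν := by
  refine ((integrable_const c).add ?_).add ?_
  · exact (IsGaussian.integrable_fun_id.sub (integrable_const a)).const_inner e
  · simp only [inner_clm_self]
    exact integrable_finsetSum _ fun i _ => integrable_finsetSum _ fun j _ =>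
      (integrable_eval_sub_mul_eval_sub ν a i j).const_mul _

theorem integral_quadratic {a : Vec d} {A : Mat d} (hA : A.PosSemidef) (e : Vec d) (c : ℝ)
    (N : Mat d) :
    ∫ x, (c + ⟪e, x - a⟫ + ⟪x - a, clm N (x - a)⟫) ∂(multivariateGaussian a A)
      = c + (N * A).trace := by
  have hi : Integrable (fun x : Vec d => x - a) (multivariateGaussian a A) :=
    IsGaussian.integrable_fun_id.sub (integrable_const a)
  have hq : Integrable (fun x => ⟪x - a, clm N (x - a)⟫) (multivariateGaussian a A) := by
    simpa using integrable_quadratic (multivariateGaussian a A) a 0 0 N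
  have hl : ∫ x, ⟪e, x - a⟫ ∂(multivariateGaussian a A) = 0 := by
    rw [integral_inner hi, integral_sub IsGaussian.integrable_fun_id (integrable_const a)]
    simp
  have h1 : Integrable (fun x : Vec d => c + ⟪e, x - a⟫) (multivariateGaussian a A) :=
    (integrable_const c).add (hi.const_inner e)
  rw [integral_add h1 hq, integral_add (integrable_const c) (hi.const_inner e), hl]
  have hs : ∫ x, ∑ i, ∑ j, N i j * ((x - a) i * (x - a) j) ∂(multivariateGaussian a A)
      = ∑ i, ∑ j, N i j * A i j := by
    have hij : ∀ i j, Integrable (fun x : Vec d => N i j * ((x - a) i * (x - a) j))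
        (multivariateGaussian a A) := fun i j =>
      (integrable_eval_sub_mul_eval_sub _ a i j).const_mul _
    rw [integral_finsetSum _ fun i _ => integrable_finsetSum _ fun j _ => hij i j]
    refine Finset.sum_congr rfl fun i _ => ?_
    rw [integral_finsetSum _ fun j _ => hij i j]
    refine Finset.sum_congr rfl fun j _ => ?_
    rw [integral_const_mul, integral_eval_sub_mul_eval_sub hA]
  simp only [inner_clm_self]
  rw [hs]
  simp only [integral_const, probReal_univ, one_smul, add_zero, add_right_inj, Matrix.trace,
    Matrix.diag, Matrix.mul_apply]
  refine Finset.sum_congr rfl fun i _ => Finset.sum_congr rfl fun j _ => ?_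
  have := hA.isHermitian.apply i j
  simp only [star_trivial] at this
  rw [this]

/-! ### Quadratic duality and the optimal map. -/

theorem inner_clm_comm {T : Mat d} (hT : T.IsHermitian) (x y : Vec d) :
    ⟪clm T x, y⟫ = ⟪x, clm T y⟫ := by
  rw [real_inner_comm, inner_toEuclideanCLM, inner_toEuclideanCLM, dotProduct_comm,
    ← vecMul_transpose, ← dotProduct_mulVec, ← conjTranspose_eq_transpose_of_trivial, hT.eq]

theorem inner_clm_self_nonneg {T : Mat d} (hT : T.PosSemidef) (x : Vec d) :
    0 ≤ ⟪x, clm T x⟫ := by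
  rw [inner_toEuclideanCLM]
  exact hT.dotProduct_mulVec_nonneg _

/-- A dual potential for the quadratic transport cost between Gaussian laws. -/
noncomputable def potential (a b : Vec d) (T : Mat d) (z : Vec d × Vec d) : ℝ :=
  (‖a - b‖ ^ 2 + ⟪(2 : ℝ) • (a - b), z.1 - a⟫ + ⟪z.1 - a, clm (1 - T) (z.1 - a)⟫)
    + (0 + ⟪-(2 : ℝ) • (a - b), z.2 - b⟫ + ⟪z.2 - b, clm (1 - T⁻¹) (z.2 - b)⟫)

/-- Completing the square. The extra term is nonnegative and vanishes on the graph of `x ↦ b + T (x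
- a)`, so this one identity gives both the lower bound for every coupling and equality for the
optimal one. -/
theorem norm_sub_sq_eq_potential_add (a b : Vec d) {T : Mat d} (hT : T.PosDef)
    (z : Vec d × Vec d) :
    ‖z.1 - z.2‖ ^ 2 = potential a b T z
      + ⟪(z.1 - a) - clm T⁻¹ (z.2 - b), clm T ((z.1 - a) - clm T⁻¹ (z.2 - b))⟫ := by
  obtain ⟨x, y⟩ := z
  obtain ⟨w, rfl⟩ : ∃ w, x = w + a := ⟨x - a, by simp⟩
  obtain ⟨v, rfl⟩ : ∃ v, y = v + b := ⟨y - b, by simp⟩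
  have hdet : IsUnit T.det := (Matrix.isUnit_iff_isUnit_det _).1 hT.isUnit
  have hTT : ∀ u, clm T (clm T⁻¹ u) = u := fun u => by
    rw [← mul_apply_eq_comp, ← map_mul, Matrix.mul_nonsing_inv _ hdet]; simp
  have e1 : w + a - (v + b) = (a - b) + (w - v) := by abel
  simp only [potential, e1, add_sub_cancel_right, map_sub, hTT, map_one,
    _root_.sub_apply, one_apply_eq_self, inner_sub_right, inner_sub_left,
    real_inner_smul_left]
  rw [norm_add_sq_real, norm_sub_sq_real w, inner_clm_comm hT.inv.isHermitian v (clm T w)]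
  have hTT' : clm T⁻¹ (clm T w) = w := by
    rw [← mul_apply_eq_comp, ← map_mul, Matrix.nonsing_inv_mul _ hdet]; simp
  rw [hTT', inner_clm_comm hT.inv.isHermitian v v]
  simp [inner_sub_right, inner_sub_left, real_inner_comm v w]
  ring

theorem ofReal_integral_le_lintegral {α : Type*} [MeasurableSpace α] {π : Measure α} {f : α → ℝ}
    (hf : Integrable f π) : ENNReal.ofReal (∫ x, f x ∂π) ≤ ∫⁻ x, ENNReal.ofReal (f x) ∂π := by
  calc ENNReal.ofReal (∫ x, f x ∂π) ≤ ENNReal.ofReal (∫ x, max (f x) 0 ∂π) :=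
        ENNReal.ofReal_le_ofReal (integral_mono hf hf.pos_part fun x => le_max_left _ _)
    _ = ∫⁻ x, ENNReal.ofReal (max (f x) 0) ∂π :=
        ofReal_integral_eq_lintegral_ofReal hf.pos_part (ae_of_all _ fun x => le_max_right _ _)
    _ = ∫⁻ x, ENNReal.ofReal (f x) ∂π := by simp [ENNReal.ofReal_max]

theorem integrable_potential (a b : Vec d) (T : Mat d) {A B : Mat d} {π : Measure (Vec d × Vec d)}
    (hπ : π ∈ couplings (multivariateGaussian a A) (multivariateGaussian b B)) :
    Integrable (potential a b T) π := by
  have h1 := integrable_quadratic (multivariateGaussian a A) a ((2 : ℝ) • (a - b)) (‖a - b‖ ^ 2)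
    (1 - T)
  have h2 := integrable_quadratic (multivariateGaussian b B) b (-(2 : ℝ) • (a - b)) 0
    (1 - T⁻¹)
  rw [← hπ.1] at h1
  rw [← hπ.2] at h2
  exact (h1.comp_measurable measurable_fst).add (h2.comp_measurable measurable_snd)

/-- The potential is a sum of functions of one variable each, so its integral depends on the
marginals alone and is the same for all couplings. -/
theorem integral_potential (a b : Vec d) (T : Mat d) {A B : Mat d} (hA : A.PosSemidef)
    (hB : B.PosSemidef) {π : Measure (Vec d × Vec d)}
    (hπ : π ∈ couplings (multivariateGaussian a A) (multivariateGaussian b B)) :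
    ∫ z, potential a b T z ∂π
      = ‖a - b‖ ^ 2 + ((1 - T) * A).trace + ((1 - T⁻¹) * B).trace := by
  have h1 := integrable_quadratic (multivariateGaussian a A) a ((2 : ℝ) • (a - b)) (‖a - b‖ ^ 2)
    (1 - T)
  have h2 := integrable_quadratic (multivariateGaussian b B) b (-(2 : ℝ) • (a - b)) 0
    (1 - T⁻¹)
  have e1 := integral_quadratic hA (a := a) ((2 : ℝ) • (a - b)) (‖a - b‖ ^ 2) (1 - T)
  have e2 := integral_quadratic hB (a := b) (-(2 : ℝ) • (a - b)) 0 (1 - T⁻¹)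
  rw [← hπ.1] at h1 e1
  rw [← hπ.2] at h2 e2
  rw [integral_map measurable_fst.aemeasurable h1.aestronglyMeasurable] at e1
  rw [integral_map measurable_snd.aemeasurable h2.aestronglyMeasurable] at e2
  have := integral_add (h1.comp_measurable measurable_fst) (h2.comp_measurable measurable_snd)
  simp only [Function.comp_def] at this
  unfold potential
  rw [this, e1, e2]
  ring

theorem map_affine_multivariateGaussian (a b : Vec d) {A B T : Mat d} (hA : A.PosSemidef)
    (hB : B.PosSemidef) (hT : T.IsHermitian) (h : T * A * T = B) :
    (multivariateGaussian a A).map (fun x => b + clm T (x - a)) = multivariateGaussian b B := by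
  have hm : AEMeasurable (fun x => b + clm T (x - a)) (multivariateGaussian a A) := by fun_prop
  have := Measure.isProbabilityMeasure_map hm
  refine Measure.ext_of_charFun ?_
  ext t
  rw [charFun_multivariateGaussian hB]
  have hexp : ∀ x : Vec d, Complex.exp (⟪b + clm T (x - a), t⟫ * Complex.I)
      = Complex.exp ((⟪b, t⟫ - ⟪clm T t, a⟫ : ℝ) * Complex.I)
        * Complex.exp (⟪x, clm T t⟫ * Complex.I) := by
    intro x
    rw [← Complex.exp_add]
    congr 1
    rw [inner_add_left, inner_clm_comm hT, inner_sub_left, real_inner_comm a]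
    push_cast
    ring
  rw [charFun_apply, integral_map hm (by fun_prop)]
  simp only [hexp]
  rw [integral_const_mul, ← charFun_apply, charFun_multivariateGaussian hA, ← Complex.exp_add]
  congr 1
  have hq : (clm T t) ⬝ᵥ A *ᵥ (clm T t) = t ⬝ᵥ B *ᵥ t := by
    rw [← inner_toEuclideanCLM, ← inner_toEuclideanCLM, inner_clm_comm hT, ← h, map_mul, map_mul]
    rfl
  rw [hq, real_inner_comm]
  push_cast
  ring

/-- **Gelbrich's formula** for nondegenerate Gaussian laws. -/
theorem wasserstein_two_sq_multivariateGaussian (a b : Vec d) {A B : Mat d} (hA : A.PosDef)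
    (hB : B.PosDef) :
    wasserstein 2 (multivariateGaussian a A) (multivariateGaussian b B) ^ 2 = Phi a b A B := by
  set R := CFC.sqrt A with hR
  set M := CFC.sqrt (R * B * R) with hM
  have hRp : R.PosDef := posDef_sqrt hA
  have hRBR : (R * B * R).PosDef := posDef_sqrt_mul_mul_sqrt hA hB
  have hMp : M.PosDef := posDef_sqrt hRBR
  have hRR : R * R = A := CFC.sqrt_mul_sqrt_self A hA.posSemidef.nonneg
  have hMM : M * M = R * B * R := CFC.sqrt_mul_sqrt_self _ hRBR.posSemidef.nonneg
  have hdR : IsUnit R.det := (Matrix.isUnit_iff_isUnit_det _).1 hRp.isUnit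
  have iR1 : R⁻¹ * R = 1 := Matrix.nonsing_inv_mul _ hdR
  have iR2 : R * R⁻¹ = 1 := Matrix.mul_nonsing_inv _ hdR
  -- The matrix of the optimal map: the positive definite solution of `T * A * T = B`.
  set T := R⁻¹ * M * R⁻¹ with hTdef
  have hT : T.PosDef := by
    have := (Matrix.IsUnit.posDef_star_right_conjugate_iff (x := M) hRp.inv.isUnit).2 hMp
    rwa [star_eq_conjTranspose, hRp.inv.isHermitian.eq] at this
  have hTA : T * A = R⁻¹ * M * R := by
    rw [hTdef, ← hRR, Matrix.mul_assoc _ R⁻¹, ← Matrix.mul_assoc R⁻¹ R, iR1, Matrix.one_mul]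
  have hTAT : T * A * T = B := by
    calc T * A * T = R⁻¹ * (M * ((R * R⁻¹) * M)) * R⁻¹ := by
          rw [hTA, hTdef]; simp only [Matrix.mul_assoc]
      _ = R⁻¹ * R * B * (R * R⁻¹) := by
          rw [iR2, Matrix.one_mul, hMM]; simp only [Matrix.mul_assoc, iR2]
      _ = B := by rw [iR1, iR2]; simp
  have hdT : IsUnit T.det := (Matrix.isUnit_iff_isUnit_det _).1 hT.isUnit
  have htr1 : (T * A).trace = M.trace := by
    rw [hTA, Matrix.trace_mul_comm, ← Matrix.mul_assoc, iR2, Matrix.one_mul]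
  have htr2 : (T⁻¹ * B).trace = M.trace := by
    rw [← hTAT, Matrix.mul_assoc, ← Matrix.mul_assoc, Matrix.nonsing_inv_mul _ hdT, Matrix.one_mul,
      Matrix.trace_mul_comm, htr1]
  have hint : ∀ π ∈ couplings (multivariateGaussian a A) (multivariateGaussian b B),
      ∫ z, potential a b T z ∂π = Phi a b A B := by
    intro π hπ
    rw [integral_potential a b T hA.posSemidef hB.posSemidef hπ, Phi]
    simp only [Matrix.sub_mul, Matrix.trace_sub, Matrix.one_mul, htr1, htr2, ← hR, ← hM]
    ring
  have hrpow : ∀ z : Vec d × Vec d, ‖z.1 - z.2‖ ^ (2 : ℝ) = ‖z.1 - z.2‖ ^ 2 := fun z =>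
    Real.rpow_two _
  have hlow : ∀ π ∈ couplings (multivariateGaussian a A) (multivariateGaussian b B),
      ENNReal.ofReal (Phi a b A B) ≤ ∫⁻ z, ENNReal.ofReal (‖z.1 - z.2‖ ^ (2 : ℝ)) ∂π := by
    intro π hπ
    rw [← hint π hπ]
    refine (ofReal_integral_le_lintegral (integrable_potential a b T hπ)).trans ?_
    refine lintegral_mono fun z => ENNReal.ofReal_le_ofReal ?_
    rw [hrpow, norm_sub_sq_eq_potential_add a b hT z]
    have := inner_clm_self_nonneg hT.posSemidef ((z.1 - a) - clm T⁻¹ (z.2 - b))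
    linarith
  set π₀ := (multivariateGaussian a A).map (fun x => (x, b + clm T (x - a))) with hπ₀
  have hmeas : Measurable (fun x : Vec d => (x, b + clm T (x - a))) := by fun_prop
  have hπmem : π₀ ∈ couplings (multivariateGaussian a A) (multivariateGaussian b B) := by
    constructor
    · rw [hπ₀, Measure.map_map measurable_fst hmeas]
      exact Measure.map_id
    · rw [hπ₀, Measure.map_map measurable_snd hmeas]
      exact map_affine_multivariateGaussian a b hA.posSemidef hB.posSemidef hT.isHermitian hTAT
  have hae : ∀ᵐ z ∂π₀, ‖z.1 - z.2‖ ^ (2 : ℝ) = potential a b T z := by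
    rw [hπ₀, ae_map_iff hmeas.aemeasurable]
    · refine ae_of_all _ fun x => ?_
      rw [hrpow, norm_sub_sq_eq_potential_add a b hT]
      have : clm T⁻¹ (clm T (x - a)) = x - a := by
        rw [← mul_apply_eq_comp, ← map_mul, Matrix.nonsing_inv_mul _ hdT]; simp
      simp only [add_sub_cancel_left, this, sub_self, map_zero, inner_zero_left, add_zero]
    · refine measurableSet_eq_fun (by fun_prop) ?_
      unfold potential
      fun_prop
  have hcost : ∫⁻ z, ENNReal.ofReal (‖z.1 - z.2‖ ^ (2 : ℝ)) ∂π₀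
      = ENNReal.ofReal (Phi a b A B) := by
    rw [← hint π₀ hπmem, ofReal_integral_eq_lintegral_ofReal (integrable_potential a b T hπmem)]
    · exact lintegral_congr_ae (hae.mono fun z hz => by simp only [hz])
    · filter_upwards [hae] with z hz
      rw [← hz]
      exact Real.rpow_nonneg (norm_nonneg _) _
  have hnonneg : 0 ≤ Phi a b A B := by
    rw [← hint π₀ hπmem]
    refine integral_nonneg_of_ae ?_
    filter_upwards [hae] with z hz
    rw [← hz]
    exact Real.rpow_nonneg (norm_nonneg _) _
  have hinf : (⨅ π ∈ couplings (multivariateGaussian a A) (multivariateGaussian b B),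
      (∫⁻ z, ENNReal.ofReal (‖z.1 - z.2‖ ^ (2 : ℝ)) ∂π) ^ (1 / (2 : ℝ)))
      = ENNReal.ofReal (Phi a b A B) ^ (1 / (2 : ℝ)) := by
    refine le_antisymm ((iInf₂_le π₀ hπmem).trans (ENNReal.rpow_le_rpow hcost.le (by norm_num))) ?_
    exact le_iInf₂ fun π hπ => ENNReal.rpow_le_rpow (hlow π hπ) (by norm_num)
  rw [wasserstein, hinf, ← ENNReal.toReal_rpow, ENNReal.toReal_ofReal hnonneg, ← Real.sqrt_eq_rpow,
    Real.sq_sqrt hnonneg]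

end Gelbrich

end GaussWass

namespace GaussWass

/-! ### Mixed moments of Gaussian vectors -/

section Moments

open scoped RealInnerProductSpace

theorem integral_pow_four_gaussianReal (v : ℝ≥0) :
    ∫ x, x ^ 4 ∂(gaussianReal 0 v) = 3 * (v : ℝ) ^ 2 := by
  have h : ∫ x, x ^ 4 ∂(gaussianReal 0 v)
      = iteratedDeriv 4 (mgf (fun x => x) (gaussianReal 0 v)) 0 := by
    rw [iteratedDeriv_mgf_zero] <;> simp
  rw [h, mgf_fun_id_gaussianReal]
  simp only [zero_mul, zero_add]
  set f : ℝ → ℝ := fun t => Real.exp (v * t ^ 2 / 2) with hf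
  have hf' : ∀ t, HasDerivAt f (v * t * f t) t := by
    intro t
    have : HasDerivAt (fun t : ℝ => (v : ℝ) * t ^ 2 / 2) (v * t) t := by
      have := ((hasDerivAt_pow 2 t).const_mul (v : ℝ)).div_const 2
      convert! this using 1
      simp; ring
    simpa [hf, mul_comm] using this.exp
  -- Derivatives of `f` of every order are polynomials times `f`; this is the recursion for the
  -- polynomial factor.
  have step : ∀ (p p' : ℝ → ℝ), (∀ t, HasDerivAt p (p' t) t) →
      deriv (fun t => p t * f t) = fun t => (p' t + p t * (v * t)) * f t := by
    intro p p' hp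
    ext t
    exact ((hp t).mul (hf' t)).deriv.trans (by ring)
  have h1 : deriv f = fun t => (v * t) * f t := funext fun t => (hf' t).deriv
  have hid : ∀ t : ℝ, HasDerivAt (fun t : ℝ => (v : ℝ) * t) v t := fun t => by
    simpa using (hasDerivAt_id t).const_mul (v : ℝ)
  have h2 := step (fun t => v * t) (fun _ => v) hid
  have h3 := step (fun t => v + v * t * (v * t)) (fun t => v * (v * t) + v * t * v) (fun t => by
    simpa using ((hid t).mul (hid t)).const_add (v : ℝ))
  have hp3 : ∀ t : ℝ, HasDerivAt (fun t : ℝ => (v * (v * t) + v * t * v)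
      + (v + v * t * (v * t)) * (v * t))
      ((v * v + v * v) + ((v * (v * t) + v * t * v) * (v * t) + (v + v * t * (v * t)) * v)) t := by
    intro t
    have a1 := ((hid t).const_mul (v : ℝ)).add ((hid t).mul_const (v : ℝ))
    have a2 := ((((hid t).mul (hid t)).const_add (v : ℝ))).mul (hid t)
    exact a1.add a2
  have h4 := step _ _ hp3
  rw [iteratedDeriv_succ, iteratedDeriv_succ, iteratedDeriv_succ, iteratedDeriv_one, h1, h2, h3, h4]
  simp [hf]
  ring

variable {d : ℕ}

theorem map_inner_multivariateGaussian_zero {S : Mat d} (hS : S.PosSemidef) (t : Vec d) :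
    (multivariateGaussian 0 S).map (fun w => ⟪t, w⟫)
      = gaussianReal 0 (t ⬝ᵥ S *ᵥ t).toNNReal := by
  have hm : AEMeasurable (fun w => ⟪t, w⟫) (multivariateGaussian 0 S) := by fun_prop
  have := Measure.isProbabilityMeasure_map hm
  have hnn : 0 ≤ t ⬝ᵥ S *ᵥ t := hS.dotProduct_mulVec_nonneg _
  refine Measure.ext_of_charFun ?_
  ext s
  rw [charFun_gaussianReal, charFun_apply_real, integral_map hm (by fun_prop)]
  have := charFun_multivariateGaussian (μ := 0) hS (s • t)
  rw [charFun_apply] at this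
  have e : ∀ w : Vec d, Complex.exp (s * (⟪t, w⟫ : ℝ) * Complex.I)
      = Complex.exp ((⟪w, s • t⟫ : ℝ) * Complex.I) := by
    intro w
    rw [inner_smul_right, real_inner_comm]
    push_cast
    rfl
  simp only [e]
  rw [this]
  congr 1
  rw [Real.coe_toNNReal _ hnn]
  simp [mulVec_smul, smul_dotProduct]
  ring

theorem integral_inner_pow_four {S : Mat d} (hS : S.PosSemidef) (t : Vec d) :
    ∫ w, ⟪t, w⟫ ^ 4 ∂(multivariateGaussian 0 S) = 3 * (t ⬝ᵥ S *ᵥ t) ^ 2 := by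
  have h := integral_map (μ := multivariateGaussian 0 S) (φ := fun w => ⟪t, w⟫)
    (f := fun x : ℝ => x ^ 4) (by fun_prop) (by fun_prop)
  rw [← h, map_inner_multivariateGaussian_zero hS, integral_pow_four_gaussianReal,
    Real.coe_toNNReal _ (by simpa using hS.dotProduct_mulVec_nonneg (t : Fin d → ℝ))]

theorem integrable_inner_pow_four (ν : Measure (Vec d)) [IsGaussian ν] (t : Vec d) :
    Integrable (fun w => ⟪t, w⟫ ^ 4) ν := by
  have : MemLp (fun w : Vec d => ⟪t, w⟫) 4 ν := (IsGaussian.memLp_id ν 4 (by simp)).const_inner t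
  have := this.integrable_norm_pow (p := 4) (by norm_num)
  refine this.congr (ae_of_all _ fun w => ?_)
  simp only [Real.norm_eq_abs]
  exact Even.pow_abs (by decide) _

/-- The sign `±1` of a Boolean. -/
def boolSign (b : Bool) : ℝ := if b then 1 else -1

/-- **Isserlis' theorem** for fourth moments. -/
theorem integral_mul_mul_mul {S : Mat d} (hS : S.PosSemidef) (i j k l : Fin d) :
    ∫ w, w i * w j * (w k * w l) ∂(multivariateGaussian 0 S)
      = S i j * S k l + S i k * S j l + S i l * S j k := by
  let e : Fin d → Vec d := fun i => EuclideanSpace.single i 1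
  let t : Bool × Bool × Bool → Vec d := fun b =>
    e i + boolSign b.1 • e j + boolSign b.2.1 • e k + boolSign b.2.2 • e l
  let c : Bool × Bool × Bool → ℝ := fun b => boolSign b.1 * boolSign b.2.1 * boolSign b.2.2
  -- Polarisation reduces the mixed moment to fourth powers of linear forms. The first sign may be
  -- fixed since the power is even; the eight remaining sign choices each contribute the product `4!
  -- = 24` times, whence `192`.
  have hpol : ∀ w : Vec d, w i * w j * (w k * w l) = (1 / 192) * ∑ b, c b * ⟪t b, w⟫ ^ 4 := by
    intro w
    simp only [t, c, e, Fintype.sum_prod_type, Fintype.sum_bool, boolSign, inner_add_left,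
      real_inner_smul_left, EuclideanSpace.inner_single_left]
    simp
    ring
  have hS' : ∀ i j, S j i = S i j := fun i j => by
    simpa using hS.isHermitian.apply i j
  simp only [hpol]
  rw [integral_const_mul, integral_finsetSum _ fun b _ =>
    (integrable_inner_pow_four _ (t b)).const_mul (c b)]
  simp only [integral_const_mul, integral_inner_pow_four hS]
  have hB : ∀ p q, (Pi.single p 1 : Fin d → ℝ) ⬝ᵥ S *ᵥ (Pi.single q 1) = S p q := by
    intro p q; simp
  simp only [t, c, e, Fintype.sum_prod_type, Fintype.sum_bool, boolSign, WithLp.ofLp_add,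
    WithLp.ofLp_smul, PiLp.ofLp_single, mulVec_add, mulVec_smul, dotProduct_add,
    add_dotProduct, smul_dotProduct, dotProduct_smul, hB]
  simp only [if_true, Bool.false_eq_true, if_false, smul_eq_mul]
  rw [hS' i j, hS' i k, hS' i l, hS' j k, hS' j l, hS' k l]
  ring

theorem map_neg_multivariateGaussian_zero {S : Mat d} (hS : S.PosSemidef) :
    (multivariateGaussian 0 S).map (fun x => -x) = multivariateGaussian 0 S := by
  have := map_affine_multivariateGaussian (0 : Vec d) 0 (A := S) (B := S) (T := -1) hS hS
    (by simp [Matrix.IsHermitian]) (by simp)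
  simpa using this

theorem map_sub_multivariateGaussian (a : Vec d) {S : Mat d} (hS : S.PosSemidef) :
    (multivariateGaussian a S).map (fun x => x - a) = multivariateGaussian 0 S := by
  have := map_affine_multivariateGaussian a 0 (A := S) (B := S) (T := 1) hS hS
    (by simp [Matrix.IsHermitian]) (by simp)
  simpa using this

/-- The integrand is odd and the centred law symmetric. This decouples mean and covariance in the
limit. -/
theorem integral_mul_mul {S : Mat d} (hS : S.PosSemidef) (i j k : Fin d) :
    ∫ w, w i * (w j * w k) ∂(multivariateGaussian 0 S) = 0 := by
  have h := integral_map (μ := multivariateGaussian 0 S) (φ := fun w => -w)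
    (f := fun w : Vec d => w i * (w j * w k)) (by fun_prop) (by fun_prop)
  rw [map_neg_multivariateGaussian_zero hS] at h
  have e : ∀ w : Vec d, (-w) i * ((-w) j * (-w) k) = -(w i * (w j * w k)) := by
    intro w; simp
  simp only [e, integral_neg] at h
  linarith

end Moments

end GaussWass

namespace GaussWass

/-! ### The first and second order statistic and the law of its limit -/

section Statistic

open scoped RealInnerProductSpace

variable {d : ℕ}

/-- Indices of the coordinates of a vector and a matrix. -/
abbrev StatIdx (d : ℕ) := Fin d ⊕ (Fin d × Fin d)

/-- Pairs of a vector and a matrix, with a Euclidean norm. -/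
abbrev StatSpace (d : ℕ) := EuclideanSpace ℝ (StatIdx d)

/-- The pair `(y, y yᵗ - S)` with `y = x - μ`. -/
noncomputable def stat (μ : Vec d) (S : Mat d) (x : Vec d) : StatSpace d :=
  WithLp.toLp 2 (Sum.elim (fun i => (x - μ) i)
    (fun p => (x - μ) p.1 * (x - μ) p.2 - S p.1 p.2))

@[simp] theorem stat_inl (μ : Vec d) (S : Mat d) (x : Vec d) (i : Fin d) :
    stat μ S x (Sum.inl i) = (x - μ) i := rfl

@[simp] theorem stat_inr (μ : Vec d) (S : Mat d) (x : Vec d) (p : Fin d × Fin d) :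
    stat μ S x (Sum.inr p) = (x - μ) p.1 * (x - μ) p.2 - S p.1 p.2 := rfl

theorem symOf_add (w w' : Fin d × Fin d → ℝ) : symOf (w + w') = symOf w + symOf w' := by
  ext i j; simp [symOf]

theorem symOf_smul (c : ℝ) (w : Fin d × Fin d → ℝ) : symOf (c • w) = c • symOf w := by
  ext i j; simp [symOf]

/-- The pair `(g, S^{1/2} H S^{1/2})` as a continuous linear function of `(g, w)`. -/
noncomputable def noiseStat (S : Mat d) : (Vec d × (Fin d × Fin d → ℝ)) →L[ℝ] StatSpace d :=
  LinearMap.toContinuousLinearMap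
    { toFun := fun gw => WithLp.toLp 2 (Sum.elim (fun i => gw.1 i)
        (fun p => (rootConj S gw.2 : Mat d) p.1 p.2))
      map_add' := by
        intro a b
        ext (i | p)
        · simp
        · simp [rootConj, symOf_add, Matrix.mul_add, Matrix.add_mul]
      map_smul' := by
        intro c a
        ext (i | p)
        · simp
        · simp [rootConj, symOf_smul] }

@[simp] theorem noiseStat_inl (S : Mat d) (gw : Vec d × (Fin d × Fin d → ℝ)) (i : Fin d) :
    noiseStat S gw (Sum.inl i) = gw.1 i := rfl

@[simp] theorem noiseStat_inr (S : Mat d) (gw : Vec d × (Fin d × Fin d → ℝ)) (p : Fin d × Fin d) :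
    noiseStat S gw (Sum.inr p) = (rootConj S gw.2 : Mat d) p.1 p.2 := rfl

/-! ### Moments of the limit vector and of the statistic. -/

instance isGaussian_pi_gaussianReal {ι : Type*} [Fintype ι] (v : ι → ℝ≥0) :
    IsGaussian (Measure.pi fun i => gaussianReal 0 (v i)) := by
  have h := (iIndepFun_pi (μ := fun i => gaussianReal 0 (v i)) (X := fun _ x => x)
    (fun i => aemeasurable_id)).hasGaussianLaw (fun i => ?_)
  · have := h.isGaussian_map
    rwa [show (fun (ω : ι → ℝ) i => ω i) = id from rfl, Measure.map_id] at this
  · refine ⟨?_⟩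
    rw [(measurePreserving_eval _ i).map_eq]
    infer_instance

instance isGaussian_noiseLaw (S : Mat d) : IsGaussian (noiseLaw S) := by
  unfold noiseLaw; infer_instance

/-- The law of `(g, S^{1/2} H S^{1/2})`. -/
noncomputable def statLaw (S : Mat d) : Measure (StatSpace d) := (noiseLaw S).map (noiseStat S)

instance isGaussian_statLaw (S : Mat d) : IsGaussian (statLaw S) := by
  unfold statLaw; infer_instance

theorem integral_statLaw (S : Mat d) {f : StatSpace d → ℝ} (hf : Continuous f) :
    ∫ v, f v ∂(statLaw S) = ∫ gw, f (noiseStat S gw) ∂(noiseLaw S) :=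
  integral_map (by fun_prop) hf.aestronglyMeasurable

theorem integral_eval_pi_gaussianReal {ι : Type*} [Fintype ι] (v : ι → ℝ≥0) (p : ι) :
    ∫ w, w p ∂(Measure.pi fun i => gaussianReal 0 (v i)) = 0 := by
  rw [integral_comp_eval (μ := fun i => gaussianReal 0 (v i)) (f := fun x : ℝ => x) (i := p)
    (by fun_prop)]
  simp

theorem integral_eval_mul_eval_pi_gaussianReal {ι : Type*} [Fintype ι] [DecidableEq ι]
    (v : ι → ℝ≥0) (p q : ι) :
    ∫ w, w p * w q ∂(Measure.pi fun i => gaussianReal 0 (v i)) = if p = q then (v p : ℝ) else 0 := by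
  split_ifs with h
  · subst h
    have hv : ∫ x, x * x ∂(gaussianReal 0 (v p)) = v p := by
      have := variance_id_gaussianReal (μ := 0) (v := v p)
      rw [variance_eq_integral (by fun_prop)] at this
      simpa [pow_two] using this
    have := integral_comp_eval (μ := fun i => gaussianReal 0 (v i)) (f := fun x : ℝ => x * x)
      (i := p) (by fun_prop)
    rw [this, hv]
  · have hind := (iIndepFun_pi (μ := fun i => gaussianReal 0 (v i)) (X := fun _ x => x)
      (fun i => aemeasurable_id)).indepFun h
    rw [hind.integral_fun_mul_eq_mul_integral (measurable_pi_apply p).aestronglyMeasurable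
        (measurable_pi_apply q).aestronglyMeasurable, integral_eval_pi_gaussianReal, zero_mul]

/-- The weights of the entries of the symmetric noise. -/
abbrev noiseVar (d : ℕ) (ij : Fin d × Fin d) : ℝ≥0 := if ij.1 = ij.2 then 2 else 1

/-- Variance `2` on the diagonal is exactly what makes one formula valid for diagonal and
off-diagonal entries alike: on the diagonal both products of deltas contribute. -/
theorem integral_symOf_mul_symOf (a b c e : Fin d) :
    ∫ w, symOf w a b * symOf w c e ∂(Measure.pi fun ij => gaussianReal 0 (noiseVar d ij))
      = (if a = c then 1 else 0) * (if b = e then 1 else 0)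
        + (if a = e then 1 else 0) * (if b = c then 1 else 0) := by
  simp only [symOf, of_apply]
  rw [integral_eval_mul_eval_pi_gaussianReal]
  simp only [noiseVar, Prod.mk.injEq]
  rcases le_total a b with h1 | h1 <;> rcases le_total c e with h2 | h2 <;>
    simp only [min_eq_left h1, max_eq_right h1, min_eq_left h2, max_eq_right h2,
      min_eq_right h1, max_eq_left h1, min_eq_right h2, max_eq_left h2] <;>
    split_ifs <;> first | (norm_num; done) | (exfalso; subst_vars; omega)

theorem integral_comp_sub_multivariateGaussian (μ : Vec d) {S : Mat d} (hS : S.PosSemidef)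
    {f : Vec d → ℝ} (hf : Continuous f) :
    ∫ x, f (x - μ) ∂(multivariateGaussian μ S) = ∫ w, f w ∂(multivariateGaussian 0 S) := by
  rw [← map_sub_multivariateGaussian μ hS, integral_map (by fun_prop) hf.aestronglyMeasurable]

/-- The covariance matrix of `(g, S^{1/2} H S^{1/2})`. -/
def statCov (S : Mat d) : StatIdx d → StatIdx d → ℝ
  | Sum.inl i, Sum.inl j => S i j
  | Sum.inr p, Sum.inr q => S p.1 q.1 * S p.2 q.2 + S p.1 q.2 * S p.2 q.1
  | _, _ => 0

theorem integral_eval_multivariateGaussian_zero_mul {S : Mat d} (hS : S.PosSemidef) (i j : Fin d) :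
    ∫ w, w i * w j ∂(multivariateGaussian 0 S) = S i j := by
  simpa using integral_eval_sub_mul_eval_sub (a := (0 : Vec d)) hS i j

theorem memLp_mul_gaussian (ν : Measure (Vec d)) [IsGaussian ν] (a : Vec d) (i j : Fin d)
    (p : ℝ≥0∞) (hp : p ≠ ∞) : MemLp (fun x : Vec d => (x - a) i * (x - a) j) p ν := by
  have : ENNReal.HolderTriple (2 * p) (2 * p) p := ⟨by
    rw [ENNReal.mul_inv (by simp) (by simp), ← add_mul, ENNReal.inv_two_add_inv_two, one_mul]⟩
  have hp2 : 2 * p ≠ ∞ := ENNReal.mul_ne_top (by simp) hp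
  exact (memLp_eval_sub_gaussian ν a j (2 * p) hp2).mul (memLp_eval_sub_gaussian ν a i (2 * p) hp2)

theorem memLp_stat (ν : Measure (Vec d)) [IsGaussian ν] (μ : Vec d) (S : Mat d)
    (p : ℝ≥0∞) (hp : p ≠ ∞) : MemLp (stat μ S) p ν := by
  refine MemLp.of_eval_piLp fun α => ?_
  rcases α with i | q
  · exact memLp_eval_sub_gaussian ν μ i p hp
  · exact (memLp_mul_gaussian ν μ q.1 q.2 p hp).sub (memLp_const _)

theorem integral_stat (μ : Vec d) {S : Mat d} (hS : S.PosSemidef) (α : StatIdx d) :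
    ∫ x, stat μ S x α ∂(multivariateGaussian μ S) = 0 := by
  rcases α with i | q
  · simp only [stat_inl, PiLp.sub_apply]
    rw [integral_sub ((memLp_eval_gaussian _ i 1 (by simp)).integrable le_rfl) (integrable_const _),
      integral_eval_multivariateGaussian]
    simp
  · simp only [stat_inr]
    rw [integral_sub (integrable_eval_sub_mul_eval_sub _ μ q.1 q.2) (integrable_const _),
      integral_eval_sub_mul_eval_sub hS]
    simp

/-- In the matrix block, centring removes one of the three pairings in Isserlis' theorem; the mixed
blocks are third moments. The result agrees with `integral_eval_mul_eval_statLaw`, which identifies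
the limit. -/
theorem integral_stat_mul_stat (μ : Vec d) {S : Mat d} (hS : S.PosSemidef) (α β : StatIdx d) :
    ∫ x, stat μ S x α * stat μ S x β ∂(multivariateGaussian μ S) = statCov S α β := by
  have hev : ∀ (i : Fin d), Integrable (fun w : Vec d => w i) (multivariateGaussian 0 S) :=
    fun i => (memLp_eval_gaussian _ i 1 (by simp)).integrable le_rfl
  have h2 : ∀ (i j : Fin d), MemLp (fun w : Vec d => w i * w j) 2 (multivariateGaussian 0 S) :=
    fun i j => by simpa using memLp_mul_gaussian (multivariateGaussian 0 S) 0 i j 2 (by simp)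
  have h21 : ∀ (i j : Fin d), Integrable (fun w : Vec d => w i * w j) (multivariateGaussian 0 S) :=
    fun i j => (h2 i j).integrable (by norm_num)
  have h3 : ∀ (i j k : Fin d), Integrable (fun w : Vec d => w i * (w j * w k))
      (multivariateGaussian 0 S) := fun i j k =>
    (memLp_eval_gaussian _ i 2 (by simp)).integrable_mul (h2 j k)
  have h4 : ∀ (i j k l : Fin d), Integrable (fun w : Vec d => w i * w j * (w k * w l))
      (multivariateGaussian 0 S) := fun i j k l => (h2 i j).integrable_mul (h2 k l)
  have hmix : ∀ (i : Fin d) (q : Fin d × Fin d),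
      ∫ x, (x - μ) i * ((x - μ) q.1 * (x - μ) q.2 - S q.1 q.2) ∂(multivariateGaussian μ S) = 0 := by
    intro i q
    rw [integral_comp_sub_multivariateGaussian μ hS
      (f := fun w => w i * (w q.1 * w q.2 - S q.1 q.2)) (by fun_prop)]
    simp only [mul_sub]
    rw [integral_sub (h3 _ _ _) ((hev i).mul_const _), integral_mul_mul hS, integral_mul_const,
      integral_eval_multivariateGaussian]
    simp
  rcases α with i | p <;> rcases β with j | q
  · exact integral_eval_sub_mul_eval_sub hS i j
  · exact hmix i q
  · simp only [stat_inl, stat_inr, statCov]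
    rw [← hmix j p]
    exact integral_congr_ae (ae_of_all _ fun x => mul_comm _ _)
  · simp only [stat_inr, statCov]
    rw [integral_comp_sub_multivariateGaussian μ hS
      (f := fun w => (w p.1 * w p.2 - S p.1 p.2) * (w q.1 * w q.2 - S q.1 q.2)) (by fun_prop)]
    have e : ∀ w : Vec d, (w p.1 * w p.2 - S p.1 p.2) * (w q.1 * w q.2 - S q.1 q.2)
        = w p.1 * w p.2 * (w q.1 * w q.2) - S q.1 q.2 * (w p.1 * w p.2)
          - (S p.1 p.2 * (w q.1 * w q.2) - S p.1 p.2 * S q.1 q.2) := fun w => by ring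
    simp only [e]
    have h5 : Integrable (fun w : Vec d => w p.1 * w p.2 * (w q.1 * w q.2)
        - S q.1 q.2 * (w p.1 * w p.2)) (multivariateGaussian 0 S) :=
      (h4 _ _ _ _).sub ((h21 _ _).const_mul _)
    have h6 : Integrable (fun w : Vec d => S p.1 p.2 * (w q.1 * w q.2)
        - S p.1 p.2 * S q.1 q.2) (multivariateGaussian 0 S) :=
      ((h21 _ _).const_mul _).sub (integrable_const _)
    rw [integral_sub h5 h6,
      integral_sub (h4 _ _ _ _) ((h21 _ _).const_mul _),
      integral_sub ((h21 _ _).const_mul _) (integrable_const _), integral_mul_mul_mul hS,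
      integral_const_mul, integral_const_mul, integral_eval_multivariateGaussian_zero_mul hS,
      integral_eval_multivariateGaussian_zero_mul hS]
    simp
    ring

theorem memLp_eval_noise (p : Fin d × Fin d) :
    MemLp (fun w : Fin d × Fin d → ℝ => w p) 2
      (Measure.pi fun ij => gaussianReal 0 (noiseVar d ij)) :=
  IsGaussian.memLp_dual (Measure.pi fun ij => gaussianReal 0 (noiseVar d ij))
    (ContinuousLinearMap.proj (R := ℝ) (φ := fun _ : Fin d × Fin d => ℝ) p) 2 (by simp)

theorem integrable_symOf_mul_symOf (a b c e : Fin d) :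
    Integrable (fun w => symOf w a b * symOf w c e)
      (Measure.pi fun ij => gaussianReal 0 (noiseVar d ij)) := by
  exact (memLp_eval_noise _).integrable_mul (memLp_eval_noise _)

theorem rootConj_apply (S : Mat d) (w : Fin d × Fin d → ℝ) (i j : Fin d) :
    (rootConj S w : Mat d) i j
      = ∑ q : Fin d × Fin d, CFC.sqrt S i q.1 * CFC.sqrt S q.2 j * symOf w q.1 q.2 := by
  simp only [rootConj, Matrix.mul_apply, Finset.sum_mul, Fintype.sum_prod_type]
  rw [Finset.sum_comm]
  exact Finset.sum_congr rfl fun a _ => Finset.sum_congr rfl fun b _ => by ring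

/-- Conjugation by `S^{1/2}` turns the Kronecker deltas in the covariance of `H` into entries of
`S^{1/2} S^{1/2} = S`. -/
theorem integral_rootConj_mul_rootConj {S : Mat d} (hS : S.PosSemidef) (i j k l : Fin d) :
    ∫ w, (rootConj S w : Mat d) i j * (rootConj S w : Mat d) k l
        ∂(Measure.pi fun ij => gaussianReal 0 (noiseVar d ij))
      = S i k * S j l + S i l * S j k := by
  set R := CFC.sqrt S with hR
  have hRR : R * R = S := CFC.sqrt_mul_sqrt_self S hS.nonneg
  have hRs : ∀ a b, R b a = R a b := fun a b => by
    have : R.IsHermitian := (CFC.sqrt_nonneg S).posSemidef.isHermitian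
    simpa using this.apply a b
  have hSe : ∀ a b, S a b = ∑ c, R a c * R b c := fun a b => by
    rw [← hRR, Matrix.mul_apply]
    exact Finset.sum_congr rfl fun c _ => by rw [hRs b c]
  simp only [rootConj_apply, ← hR, Finset.sum_mul_sum]
  have hint : ∀ p q : Fin d × Fin d, Integrable (fun w =>
      R i p.1 * R p.2 j * symOf w p.1 p.2 * (R k q.1 * R q.2 l * symOf w q.1 q.2))
      (Measure.pi fun ij => gaussianReal 0 (noiseVar d ij)) := by
    intro p q
    refine ((integrable_symOf_mul_symOf p.1 p.2 q.1 q.2).const_mul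
      (R i p.1 * R p.2 j * (R k q.1 * R q.2 l))).congr (ae_of_all _ fun w => ?_)
    ring
  rw [integral_finsetSum _ fun p _ => integrable_finsetSum _ fun q _ => hint p q]
  have : ∀ p : Fin d × Fin d, ∫ w, ∑ q : Fin d × Fin d,
      R i p.1 * R p.2 j * symOf w p.1 p.2 * (R k q.1 * R q.2 l * symOf w q.1 q.2)
        ∂(Measure.pi fun ij => gaussianReal 0 (noiseVar d ij))
      = R i p.1 * R j p.2 * R k p.1 * R l p.2 + R i p.1 * R j p.2 * R k p.2 * R l p.1 := by
    intro p
    have e : ∀ (w : Fin d × Fin d → ℝ) (q : Fin d × Fin d),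
        R i p.1 * R p.2 j * symOf w p.1 p.2 * (R k q.1 * R q.2 l * symOf w q.1 q.2)
        = (R i p.1 * R p.2 j * (R k q.1 * R q.2 l)) * (symOf w p.1 p.2 * symOf w q.1 q.2) :=
      fun w q => by ring
    simp only [e]
    rw [integral_finsetSum _ fun q _ => (integrable_symOf_mul_symOf p.1 p.2 q.1 q.2).const_mul _]
    simp only [integral_const_mul, integral_symOf_mul_symOf, mul_add, Finset.sum_add_distrib,
      Fintype.sum_prod_type]
    simp [hRs j, hRs l, mul_assoc]
  rw [Finset.sum_congr rfl fun p _ => this p, Finset.sum_add_distrib]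
  simp only [hSe, Finset.sum_mul_sum, Fintype.sum_prod_type]
  congr 1
  · exact Finset.sum_congr rfl fun a _ => Finset.sum_congr rfl fun b _ => by ring
  · exact Finset.sum_congr rfl fun a _ => Finset.sum_congr rfl fun b _ => by ring

theorem integral_rootConj {S : Mat d} (i j : Fin d) :
    ∫ w, (rootConj S w : Mat d) i j ∂(Measure.pi fun ij => gaussianReal 0 (noiseVar d ij)) = 0 := by
  simp only [rootConj_apply]
  rw [integral_finsetSum]
  · refine Finset.sum_eq_zero fun p _ => ?_
    rw [integral_const_mul]
    simp only [symOf, of_apply]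
    rw [integral_eval_pi_gaussianReal, mul_zero]
  · intro p _
    refine Integrable.const_mul ?_ _
    exact (memLp_eval_noise _).integrable (by norm_num)

theorem integral_eval_statLaw (S : Mat d) (α : StatIdx d) : ∫ v, v α ∂(statLaw S) = 0 := by
  rw [integral_statLaw S (by fun_prop)]
  rcases α with i | p
  · simp only [noiseStat_inl, noiseLaw]
    rw [integral_fun_fst (fun g : Vec d => g i), integral_eval_multivariateGaussian]
    simp
  · simp only [noiseStat_inr, noiseLaw]
    rw [integral_fun_snd (fun w => (rootConj S w : Mat d) p.1 p.2), integral_rootConj, smul_zero]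

theorem integral_eval_mul_eval_statLaw {S : Mat d} (hS : S.PosSemidef) (α β : StatIdx d) :
    ∫ v, v α * v β ∂(statLaw S) = statCov S α β := by
  rw [integral_statLaw S (by fun_prop)]
  have hmix : ∀ (i : Fin d) (q : Fin d × Fin d),
      ∫ gw : Vec d × (Fin d × Fin d → ℝ), gw.1 i * (rootConj S gw.2 : Mat d) q.1 q.2
        ∂(noiseLaw S) = 0 := by
    intro i q
    unfold noiseLaw
    rw [integral_prod_mul (fun g : Vec d => g i) (fun w => (rootConj S w : Mat d) q.1 q.2),
      integral_rootConj, mul_zero]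
  rcases α with i | p <;> rcases β with j | q
  · simp only [noiseStat_inl, noiseLaw, statCov]
    rw [integral_fun_fst (fun g : Vec d => g i * g j),
      integral_eval_multivariateGaussian_zero_mul hS]
    simp
  · exact hmix i q
  · simp only [noiseStat_inl, noiseStat_inr, statCov]
    rw [← hmix j p]
    exact integral_congr_ae (ae_of_all _ fun x => mul_comm _ _)
  · simp only [noiseStat_inr, noiseLaw, statCov]
    rw [integral_fun_snd (fun w => (rootConj S w : Mat d) p.1 p.2 * (rootConj S w : Mat d) q.1 q.2),
      integral_rootConj_mul_rootConj hS]
    simp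

theorem charFun_statLaw {S : Mat d} (hS : S.PosSemidef) (t : StatSpace d) :
    charFun (statLaw S) t
      = Complex.exp (-(((∑ α, ∑ β, t α * t β * statCov S α β : ℝ) : ℂ) / 2)) := by
  have hexp : ∀ v : StatSpace d, ⟪t, v⟫ = ∑ α, t α * v α := fun v => by
    simp [PiLp.inner_apply, mul_comm]
  have hint : ∀ α, MemLp (fun v : StatSpace d => v α) 2 (statLaw S) := fun α =>
    (IsGaussian.memLp_id (statLaw S) 2 (by simp)).eval_piLp α
  have hmean : ∫ v, ⟪t, v⟫ ∂(statLaw S) = 0 := by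
    simp only [hexp]
    rw [integral_finsetSum _ fun α _ => ((hint α).integrable (by norm_num)).const_mul _]
    simp [integral_const_mul, integral_eval_statLaw]
  have hvar : Var[fun v => ⟪t, v⟫; statLaw S] = ∑ α, ∑ β, t α * t β * statCov S α β := by
    rw [variance_eq_integral (by fun_prop), hmean]
    simp only [hexp, sub_zero, pow_two, Finset.sum_mul_sum]
    have e : ∀ (v : StatSpace d) α β, t α * v α * (t β * v β) = t α * t β * (v α * v β) :=
      fun v α β => by ring
    have hij : ∀ α β, Integrable (fun v : StatSpace d => t α * t β * (v α * v β)) (statLaw S) :=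
      fun α β => ((hint α).integrable_mul (hint β)).const_mul _
    simp only [e]
    rw [integral_finsetSum _ fun α _ => integrable_finsetSum _ fun β _ => hij α β]
    refine Finset.sum_congr rfl fun α _ => ?_
    rw [integral_finsetSum _ fun β _ => hij α β]
    refine Finset.sum_congr rfl fun β _ => ?_
    rw [integral_const_mul, integral_eval_mul_eval_statLaw hS]
  rw [IsGaussian.charFun_eq, hvar, integral_complex_ofReal, hmean]
  simp

end Statistic

end GaussWass

namespace GaussWass

/-! ### Powers of characteristic functions -/

section PowerLimit

/-- Taylor's bound for `|x| ≤ 1`; for `|x| ≥ 1` the triangle inequality gives at most `3.5 |x|³`, so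
`4` serves both ranges. Validity for all `x` lets third absolute moments control the error without
truncation. -/
theorem norm_exp_mul_I_sub_le (x : ℝ) :
    ‖Complex.exp (x * Complex.I) - (1 + x * Complex.I - (x : ℂ) ^ 2 / 2)‖ ≤ 4 * |x| ^ 3 := by
  rcases le_total |x| 1 with h | h
  · have hn : ‖(x * Complex.I : ℂ)‖ = |x| := by simp
    have := Complex.exp_bound (x := x * Complex.I) (by rw [hn]; exact h) (n := 3) (by norm_num)
    rw [hn] at this
    have e : ∑ m ∈ Finset.range 3, (x * Complex.I : ℂ) ^ m / (m.factorial : ℂ)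
        = 1 + x * Complex.I - (x : ℂ) ^ 2 / 2 := by
      simp [Finset.sum_range_succ, mul_pow, Nat.factorial]
      ring
    rw [e] at this
    refine this.trans ?_
    have h0 : 0 ≤ |x| ^ 3 := by positivity
    simp only [Nat.succ_eq_add_one, Nat.factorial]
    push_cast
    nlinarith
  · have h1 : ‖Complex.exp (x * Complex.I)‖ = 1 := Complex.norm_exp_ofReal_mul_I x
    have h2 : ‖(1 + x * Complex.I - (x : ℂ) ^ 2 / 2)‖ ≤ 1 + |x| + |x| ^ 2 / 2 := by
      refine (norm_sub_le _ _).trans (add_le_add ((norm_add_le _ _).trans ?_) ?_) <;> simp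
    refine (norm_sub_le _ _).trans ?_
    rw [h1]
    have h3 : |x| ≤ |x| ^ 2 := by nlinarith
    have h4 : |x| ^ 2 ≤ |x| ^ 3 := by nlinarith [sq_nonneg |x|]
    linarith

theorem norm_pow_sub_pow_le_mul {a b : ℂ} (ha : ‖a‖ ≤ 1) (hb : ‖b‖ ≤ 1) (m : ℕ) :
    ‖a ^ m - b ^ m‖ ≤ m * ‖a - b‖ := by
  induction m with
  | zero => simp
  | succ m ih =>
    have e : a ^ (m + 1) - b ^ (m + 1) = a ^ m * (a - b) + (a ^ m - b ^ m) * b := by ring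
    rw [e]
    refine (norm_add_le _ _).trans ?_
    rw [norm_mul, norm_mul, norm_pow]
    have h1 : ‖a‖ ^ m * ‖a - b‖ ≤ 1 * ‖a - b‖ := by
      gcongr
      exact pow_le_one₀ (norm_nonneg _) ha
    have h2 : ‖a ^ m - b ^ m‖ * ‖b‖ ≤ (m * ‖a - b‖) * 1 := by gcongr
    push_cast
    linarith

/-- Comparison with `exp (-c / m k)` avoids complex logarithms: both bases lie in the unit disc, so
their powers differ by at most `m k` times the difference of the bases, which tends to `0`. -/
theorem tendsto_pow_exp_neg {a : ℕ → ℂ} {m : ℕ → ℕ} {c : ℝ} (hc : 0 ≤ c) (ha : ∀ k, ‖a k‖ ≤ 1)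
    (hm : Tendsto m atTop atTop)
    (h : Tendsto (fun k => (m k : ℂ) * (a k - 1)) atTop (𝓝 (-(c : ℂ)))) :
    Tendsto (fun k => a k ^ m k) atTop (𝓝 (Complex.exp (-(c : ℂ)))) := by
  set b : ℕ → ℂ := fun k => Complex.exp (-(c : ℂ) / m k) with hb
  have hmr : Tendsto (fun k => (m k : ℝ)) atTop atTop := tendsto_natCast_atTop_atTop.comp hm
  have hb1 : ∀ k, ‖b k‖ ≤ 1 := fun k => by
    simp only [hb]
    have e : (-(c : ℂ) / m k) = ((-(c / m k) : ℝ) : ℂ) := by push_cast; ring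
    rw [e, Complex.norm_exp_ofReal, Real.exp_le_one_iff]
    have : 0 ≤ c / m k := by positivity
    linarith
  have hpos : ∀ᶠ k in atTop, 1 ≤ m k := hm.eventually_ge_atTop 1
  have hbm : ∀ᶠ k in atTop, b k ^ m k = Complex.exp (-(c : ℂ)) := by
    filter_upwards [hpos] with k hk
    rw [hb, ← Complex.exp_nat_mul]
    congr 1
    have : (m k : ℂ) ≠ 0 := by exact_mod_cast (by omega : m k ≠ 0)
    field_simp
  have hmb : Tendsto (fun k => (m k : ℂ) * (b k - 1) + c) atTop (𝓝 0) := by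
    have hsmall : ∀ᶠ k in atTop, c / (m k : ℝ) ≤ 1 :=
      (hmr.const_div_atTop c).eventually (eventually_le_nhds one_pos)
    have hlim : Tendsto (fun k => c ^ 2 / (m k : ℝ)) atTop (𝓝 0) := hmr.const_div_atTop _
    refine squeeze_zero_norm' ?_ hlim
    filter_upwards [hpos, hsmall] with k hk hk1
    have hmk : (0 : ℝ) < m k := by exact_mod_cast hk
    have hmk' : (m k : ℂ) ≠ 0 := by exact_mod_cast (by omega : m k ≠ 0)
    have hnorm : ‖(-(c : ℂ) / m k)‖ = c / m k := by
      rw [norm_div, norm_neg, Complex.norm_real, Complex.norm_natCast, Real.norm_of_nonneg hc]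
    have := Complex.norm_exp_sub_one_sub_id_le (x := -(c : ℂ) / m k) (by rw [hnorm]; exact hk1)
    rw [hnorm] at this
    have e : (m k : ℂ) * (b k - 1) + c = m k * (Complex.exp (-(c : ℂ) / m k) - 1 - -(c : ℂ) / m k) := by
      simp only [hb]
      field_simp
      ring
    rw [e, norm_mul, Complex.norm_natCast]
    calc (m k : ℝ) * _ ≤ m k * (c / m k) ^ 2 := by gcongr
      _ = c ^ 2 / m k := by field_simp
  have hdiff : Tendsto (fun k => a k ^ m k - b k ^ m k) atTop (𝓝 0) := by
    have h0 : Tendsto (fun k => (m k : ℂ) * (a k - b k)) atTop (𝓝 0) := by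
      have := (h.add_const (c : ℂ)).sub hmb
      simp only [neg_add_cancel, sub_zero] at this
      refine this.congr fun k => by ring
    have h0n : Tendsto (fun k => ‖(m k : ℂ) * (a k - b k)‖) atTop (𝓝 0) := by simpa using h0.norm
    refine squeeze_zero_norm (fun k => ?_) h0n
    refine (norm_pow_sub_pow_le_mul (ha k) (hb1 k) (m k)).trans ?_
    simp
  have hbt : Tendsto (fun k => b k ^ m k) atTop (𝓝 (Complex.exp (-(c : ℂ)))) :=
    tendsto_const_nhds.congr' (hbm.mono fun k hk => hk.symm)
  simpa using hdiff.add hbt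

end PowerLimit

/-! ### Extended continuous mapping -/

section ContinuousMapping

/-- Portmanteau with open sets: joint convergence covers `h' ⁻¹' G` by the increasing open sets on
whose points `h k` lies in `G` for all `k ≥ j`. Going through `Y` and `Z` on auxiliary spaces means
that `h k` itself need not be measurable, as is convenient for the Wasserstein functional. -/
theorem tendsto_map_of_tendsto_prod {V : Type*} [TopologicalSpace V] [MeasurableSpace V]
    [OpensMeasurableSpace V] [HasOuterApproxClosed V] {ν : ℕ → ProbabilityMeasure V}
    {ν' : ProbabilityMeasure V} (hν : Tendsto ν atTop (𝓝 ν'))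
    {Ω : ℕ → Type*} [∀ k, MeasurableSpace (Ω k)] {P : ∀ k, Measure (Ω k)}
    {Z : ∀ k, Ω k → V} (hZ : ∀ k, Measurable (Z k)) (hmap : ∀ k, (P k).map (Z k) = ν k)
    {h : ℕ → V → ℝ} {Y : ∀ k, Ω k → ℝ} (hY : ∀ k, Measurable (Y k))
    (hYZ : ∀ k ω, Y k ω = h k (Z k ω)) {h' : V → ℝ} (hh' : Measurable h')
    (hconv : ∀ v, Tendsto (fun p : ℕ × V => h p.1 p.2) (atTop ×ˢ 𝓝 v) (𝓝 (h' v)))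
    {ρ : ℕ → ProbabilityMeasure ℝ} {ρ' : ProbabilityMeasure ℝ}
    (hρ : ∀ k, (ρ k : Measure ℝ) = (P k).map (Y k))
    (hρ' : (ρ' : Measure ℝ) = (ν' : Measure V).map h') :
    Tendsto ρ atTop (𝓝 ρ') := by
  refine tendsto_of_forall_isOpen_le_liminf' fun G hG => ?_
  let O : ℕ → Set V := fun j => interior {v | ∀ k, j ≤ k → h k v ∈ G}
  have hO : ∀ j, IsOpen (O j) := fun j => isOpen_interior
  have hmono : Monotone O := fun i j hij =>
    interior_mono fun v hv k hk => hv k (hij.trans hk)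
  have hsub : h' ⁻¹' G ⊆ ⋃ j, O j := by
    intro v hv
    have := (hconv v).eventually (hG.mem_nhds hv)
    rw [eventually_prod_iff] at this
    obtain ⟨pa, hpa, pb, hpb, hab⟩ := this
    obtain ⟨j, hj⟩ := eventually_atTop.1 hpa
    refine Set.mem_iUnion.2 ⟨j, mem_interior_iff_mem_nhds.2 ?_⟩
    filter_upwards [hpb] with w hw k hk
    exact hab (hj k hk) hw
  have hj : ∀ j, (ν' : Measure V) (O j) ≤ atTop.liminf (fun k => (ρ k : Measure ℝ) G) := by
    intro j
    refine (ProbabilityMeasure.le_liminf_measure_open_of_tendsto hν (hO j)).trans ?_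
    refine liminf_le_liminf ?_
    filter_upwards [eventually_ge_atTop j] with k hk
    rw [← hmap k, hρ k, Measure.map_apply (hZ k) (hO j).measurableSet,
      Measure.map_apply (hY k) hG.measurableSet]
    refine measure_mono fun ω hω => ?_
    change Y k ω ∈ G
    rw [hYZ]
    exact interior_subset hω k hk
  rw [hρ', Measure.map_apply hh' hG.measurableSet]
  refine (measure_mono hsub).trans ?_
  rw [hmono.measure_iUnion]
  exact iSup_le hj

theorem tendsto_levyProkhorovDist {ρ : ℕ → ProbabilityMeasure ℝ} {ρ' : ProbabilityMeasure ℝ}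
    (h : Tendsto ρ atTop (𝓝 ρ')) :
    Tendsto (fun k => levyProkhorovDist (ρ k : Measure ℝ) (ρ' : Measure ℝ)) atTop (𝓝 0) := by
  have := (LevyProkhorov.continuous_ofMeasure_probabilityMeasure (Ω := ℝ)).continuousAt.tendsto.comp h
  rw [tendsto_iff_dist_tendsto_zero] at this
  exact this

end ContinuousMapping

/-! ### Central limit theorem for resampled sums -/

section Resampling

open scoped RealInnerProductSpace

variable {d : ℕ}

theorem integral_uniformOn_fin {E : Type*} [NormedAddCommGroup E] [NormedSpace ℝ E]
    [CompleteSpace E] {n : ℕ} [NeZero n] (f : Fin n → E) :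
    ∫ j, f j ∂(uniformOn (Set.univ : Set (Fin n))) = (n : ℝ)⁻¹ • ∑ j, f j := by
  rw [integral_fintype (Integrable.of_finite), Finset.smul_sum]
  refine Finset.sum_congr rfl fun j _ => ?_
  congr 1
  rw [measureReal_def, uniformOn_univ]
  simp

/-- The empirical average of the statistic. -/
noncomputable def statAvg (μ : Vec d) (S : Mat d) {n : ℕ} (x : Fin n → Vec d) : StatSpace d :=
  (n : ℝ)⁻¹ • ∑ i, stat μ S (x i)

/-- The law of the resampling indices. -/
noncomputable abbrev resampleLaw (n m : ℕ) : Measure (Fin m → Fin n) :=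
  Measure.pi fun _ : Fin m => uniformOn (Set.univ : Set (Fin n))

theorem charFun_map_resample (μ : Vec d) (S : Mat d) {n m : ℕ} [NeZero n] (x : Fin n → Vec d)
    (t : StatSpace d) :
    charFun ((resampleLaw n m).map fun J => √m • statAvg μ S fun k => x (J k)) t
      = ((n : ℂ)⁻¹ * ∑ j, Complex.exp ((√m * (m : ℝ)⁻¹ * ⟪t, stat μ S (x j)⟫ : ℝ) * Complex.I)) ^ m := by
  rw [charFun_apply, integral_map (Measurable.of_discrete).aemeasurable (by fun_prop)]
  have e : ∀ J : Fin m → Fin n,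
      Complex.exp ((⟪√m • statAvg μ S fun k => x (J k), t⟫ : ℝ) * Complex.I)
      = ∏ k, Complex.exp ((√m * (m : ℝ)⁻¹ * ⟪t, stat μ S (x (J k))⟫ : ℝ) * Complex.I) := by
    intro J
    rw [← Complex.exp_sum]
    congr 1
    rw [statAvg, real_inner_smul_left, real_inner_smul_left, sum_inner, ← Finset.sum_mul,
      ← Complex.ofReal_sum, ← mul_assoc, Finset.mul_sum]
    simp only [real_inner_comm]
  simp only [e]
  rw [integral_fintype_prod_eq_pow
    (fun j => Complex.exp ((√m * (m : ℝ)⁻¹ * ⟪t, stat μ S (x j)⟫ : ℝ) * Complex.I)),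
    integral_uniformOn_fin, Fintype.card_fin]
  simp

theorem norm_avg_exp_le_one {n : ℕ} [NeZero n] (s : Fin n → ℝ) :
    ‖(n : ℂ)⁻¹ * ∑ j, Complex.exp ((s j : ℂ) * Complex.I)‖ ≤ 1 := by
  have hn : (n : ℝ) ≠ 0 := by exact_mod_cast NeZero.ne n
  rw [norm_mul, norm_inv, Complex.norm_natCast]
  have : ‖∑ j, Complex.exp ((s j : ℂ) * Complex.I)‖ ≤ n := by
    refine (norm_sum_le _ _).trans ?_
    simp [Complex.norm_exp_ofReal_mul_I]
  calc (n : ℝ)⁻¹ * _ ≤ (n : ℝ)⁻¹ * n := by gcongr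
    _ = 1 := inv_mul_cancel₀ hn

theorem norm_avg_exp_sub_le {n : ℕ} [NeZero n] (c : ℝ) (hc : 0 ≤ c) (s : Fin n → ℝ) :
    ‖(n : ℂ)⁻¹ * ∑ j, Complex.exp ((c * s j : ℝ) * Complex.I)
        - (1 + (c * ((n : ℝ)⁻¹ * ∑ j, s j) : ℝ) * Complex.I
          - ((c ^ 2 * ((n : ℝ)⁻¹ * ∑ j, s j ^ 2) / 2 : ℝ) : ℂ))‖
      ≤ 4 * c ^ 3 * ((n : ℝ)⁻¹ * ∑ j, |s j| ^ 3) := by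
  have hn : (n : ℂ) ≠ 0 := by exact_mod_cast NeZero.ne n
  have e : (n : ℂ)⁻¹ * ∑ j, Complex.exp ((c * s j : ℝ) * Complex.I)
        - (1 + (c * ((n : ℝ)⁻¹ * ∑ j, s j) : ℝ) * Complex.I
          - ((c ^ 2 * ((n : ℝ)⁻¹ * ∑ j, s j ^ 2) / 2 : ℝ) : ℂ))
      = (n : ℂ)⁻¹ * ∑ j, (Complex.exp ((c * s j : ℝ) * Complex.I)
        - (1 + (c * s j : ℝ) * Complex.I - ((c * s j : ℝ) : ℂ) ^ 2 / 2)) := by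
    rw [Finset.sum_sub_distrib, Finset.sum_sub_distrib, Finset.sum_add_distrib, mul_sub]
    congr 1
    simp only [Finset.sum_const, Finset.card_univ, Fintype.card_fin, nsmul_eq_mul, mul_one, mul_sub,
      mul_add, ← Finset.sum_mul, ← Finset.sum_div]
    rw [inv_mul_cancel₀ hn]
    push_cast
    simp only [mul_pow, ← Finset.mul_sum]
    ring
  rw [e, norm_mul, norm_inv, Complex.norm_natCast]
  have : ‖∑ j, (Complex.exp ((c * s j : ℝ) * Complex.I)
        - (1 + (c * s j : ℝ) * Complex.I - ((c * s j : ℝ) : ℂ) ^ 2 / 2))‖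
      ≤ ∑ j, 4 * c ^ 3 * |s j| ^ 3 := by
    refine (norm_sum_le _ _).trans (Finset.sum_le_sum fun j _ => ?_)
    refine (norm_exp_mul_I_sub_le _).trans (le_of_eq ?_)
    rw [abs_mul, abs_of_nonneg hc, mul_pow]
    ring
  calc (n : ℝ)⁻¹ * _ ≤ (n : ℝ)⁻¹ * ∑ j, 4 * c ^ 3 * |s j| ^ 3 := by gcongr
    _ = _ := by rw [← Finset.mul_sum]; ring

/-- With `φ` the characteristic function of one scaled draw, `m (φ - 1)` has linear part `i √m`
times the data average, which vanishes by `h1`, and quadratic part tending to `-q / 2`. The third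
order error is of order `m^{-1/2}` times a convergent third moment. -/
theorem tendsto_charFun_map_resample (μ : Vec d) {S : Mat d} (hS : S.PosSemidef) {n m : ℕ → ℕ}
    [∀ k, NeZero (n k)] (hm : Tendsto m atTop atTop) (x : ∀ k, Fin (n k) → Vec d)
    (h1 : Tendsto (fun k => √(m k) • statAvg μ S (x k)) atTop (𝓝 0))
    (h2 : ∀ α β, Tendsto (fun k => ((n k : ℝ)⁻¹ * ∑ j, stat μ S (x k j) α * stat μ S (x k j) β))
      atTop (𝓝 (statCov S α β)))
    {K : ℝ} (h3 : Tendsto (fun k => ((n k : ℝ)⁻¹ * ∑ j, ‖stat μ S (x k j)‖ ^ 3)) atTop (𝓝 K))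
    (t : StatSpace d) :
    Tendsto (fun k => charFun ((resampleLaw (n k) (m k)).map
      fun J => √(m k) • statAvg μ S fun i => x k (J i)) t) atTop (𝓝 (charFun (statLaw S) t)) := by
  set q : ℝ := ∑ α, ∑ β, t α * t β * statCov S α β with hq
  have hexp : ∀ v : StatSpace d, ⟪t, v⟫ = ∑ α, t α * v α := fun v => by
    simp [PiLp.inner_apply, mul_comm]
  let s : ∀ k, Fin (n k) → ℝ := fun k j => ⟪t, stat μ S (x k j)⟫
  let c : ℕ → ℝ := fun k => √(m k) * (m k : ℝ)⁻¹
  have hc0 : ∀ k, 0 ≤ c k := fun k => by positivity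
  have hmr : Tendsto (fun k => (m k : ℝ)) atTop atTop := tendsto_natCast_atTop_atTop.comp hm
  have hpos : ∀ᶠ k in atTop, 1 ≤ m k := hm.eventually_ge_atTop 1
  have hcm : ∀ᶠ k in atTop, (m k : ℝ) * c k = √(m k) ∧ (m k : ℝ) * c k ^ 2 = 1 ∧
      (m k : ℝ) * c k ^ 3 = c k := by
    filter_upwards [hpos] with k hk
    have hmk : (m k : ℝ) ≠ 0 := by exact_mod_cast (by omega : m k ≠ 0)
    have hsq : √(m k : ℝ) ^ 2 = m k := Real.sq_sqrt (Nat.cast_nonneg _)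
    have h2 : (m k : ℝ) * c k ^ 2 = 1 := by
      simp only [c, mul_pow, hsq]; field_simp
    refine ⟨by simp only [c]; field_simp, h2, ?_⟩
    calc (m k : ℝ) * c k ^ 3 = ((m k : ℝ) * c k ^ 2) * c k := by ring
      _ = c k := by rw [h2, one_mul]
  have hc : Tendsto c atTop (𝓝 0) := by
    have : Tendsto (fun k => (√(m k : ℝ))⁻¹) atTop (𝓝 0) :=
      tendsto_inv_atTop_zero.comp (Real.tendsto_sqrt_atTop.comp hmr)
    refine this.congr fun k => ?_
    simp only [c]
    rw [← div_eq_mul_inv, Real.sqrt_div_self']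
    exact (one_div _).symm
  have hs1 : Tendsto (fun k => √(m k) * ((n k : ℝ)⁻¹ * ∑ j, s k j)) atTop (𝓝 0) := by
    have := (tendsto_const_nhds (x := t)).inner (𝕜 := ℝ) h1
    rw [inner_zero_right] at this
    refine this.congr fun k => ?_
    rw [statAvg, inner_smul_right, inner_smul_right, inner_sum]
  have hs2 : Tendsto (fun k => ((n k : ℝ)⁻¹ * ∑ j, s k j ^ 2)) atTop (𝓝 q) := by
    have : Tendsto (fun k => ∑ α, ∑ β, t α * t β *
        ((n k : ℝ)⁻¹ * ∑ j, stat μ S (x k j) α * stat μ S (x k j) β)) atTop (𝓝 q) :=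
      tendsto_finsetSum _ fun α _ => tendsto_finsetSum _ fun β _ => (h2 α β).const_mul _
    refine this.congr fun k => ?_
    have e : ∀ j, s k j ^ 2 = ∑ α : StatIdx d, ∑ β : StatIdx d,
        t α * t β * (stat μ S (x k j) α * stat μ S (x k j) β) := by
      intro j
      simp only [s, hexp, pow_two, Finset.sum_mul_sum]
      exact Finset.sum_congr rfl fun α _ => Finset.sum_congr rfl fun β _ => by ring
    conv_rhs => rw [Finset.sum_congr rfl fun j _ => e j, Finset.sum_comm, Finset.mul_sum]
    refine Finset.sum_congr rfl fun α _ => ?_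
    conv_rhs => rw [Finset.sum_comm, Finset.mul_sum]
    refine Finset.sum_congr rfl fun β _ => ?_
    rw [← Finset.mul_sum]
    ring
  have hq0 : 0 ≤ q := by
    refine ge_of_tendsto' hs2 fun k => ?_
    have : 0 ≤ ∑ j, s k j ^ 2 := Finset.sum_nonneg fun j _ => sq_nonneg _
    positivity
  have hs3 : Tendsto (fun k => 4 * c k * ((n k : ℝ)⁻¹ * ∑ j, |s k j| ^ 3)) atTop (𝓝 0) := by
    have hb : Tendsto (fun k => 4 * c k * (‖t‖ ^ 3 * ((n k : ℝ)⁻¹ * ∑ j, ‖stat μ S (x k j)‖ ^ 3)))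
        atTop (𝓝 (4 * 0 * (‖t‖ ^ 3 * K))) := (hc.const_mul 4).mul (h3.const_mul _)
    rw [mul_zero, zero_mul] at hb
    refine squeeze_zero (fun k => ?_) (fun k => ?_) hb
    · have := hc0 k
      positivity
    · have := hc0 k
      rw [mul_left_comm (‖t‖ ^ 3)]
      gcongr
      rw [Finset.mul_sum]
      refine Finset.sum_le_sum fun j _ => ?_
      rw [← mul_pow]
      gcongr
      exact abs_real_inner_le_norm _ _
  have hmain : Tendsto (fun k => (m k : ℂ) * ((n k : ℂ)⁻¹ *
      ∑ j, Complex.exp ((c k * s k j : ℝ) * Complex.I) - 1)) atTop (𝓝 (-((q / 2 : ℝ) : ℂ))) := by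
    have hA : Tendsto (fun k => ((√(m k) * ((n k : ℝ)⁻¹ * ∑ j, s k j) : ℝ) : ℂ) * Complex.I
        - ((((n k : ℝ)⁻¹ * ∑ j, s k j ^ 2) / 2 : ℝ) : ℂ)) atTop (𝓝 (-((q / 2 : ℝ) : ℂ))) := by
      have a1 := ((Complex.continuous_ofReal.tendsto 0).comp hs1).mul_const Complex.I
      have a2 := (Complex.continuous_ofReal.tendsto (q / 2)).comp (hs2.div_const 2)
      have := a1.sub a2
      simpa [Function.comp_def] using this
    have hB : Tendsto (fun k => (m k : ℂ) * ((n k : ℂ)⁻¹ *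
      ∑ j, Complex.exp ((c k * s k j : ℝ) * Complex.I) - 1)
      - (((√(m k) * ((n k : ℝ)⁻¹ * ∑ j, s k j) : ℝ) : ℂ) * Complex.I
        - ((((n k : ℝ)⁻¹ * ∑ j, s k j ^ 2) / 2 : ℝ) : ℂ))) atTop (𝓝 0) := by
      refine squeeze_zero_norm' ?_ hs3
      filter_upwards [hcm] with k hk
      obtain ⟨e1, e2, e3⟩ := hk
      have hbound := norm_avg_exp_sub_le (c k) (hc0 k) (s k)
      have e : (m k : ℂ) * ((n k : ℂ)⁻¹ * ∑ j, Complex.exp ((c k * s k j : ℝ) * Complex.I) - 1)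
          - (((√(m k) * ((n k : ℝ)⁻¹ * ∑ j, s k j) : ℝ) : ℂ) * Complex.I
          - ((((n k : ℝ)⁻¹ * ∑ j, s k j ^ 2) / 2 : ℝ) : ℂ))
          = (m k : ℂ) * ((n k : ℂ)⁻¹ * ∑ j, Complex.exp ((c k * s k j : ℝ) * Complex.I)
            - (1 + (c k * ((n k : ℝ)⁻¹ * ∑ j, s k j) : ℝ) * Complex.I
            - ((c k ^ 2 * ((n k : ℝ)⁻¹ * ∑ j, s k j ^ 2) / 2 : ℝ) : ℂ))) := by
        have f1 : ((√(m k) * ((n k : ℝ)⁻¹ * ∑ j, s k j) : ℝ) : ℂ)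
            = (m k : ℂ) * ((c k * ((n k : ℝ)⁻¹ * ∑ j, s k j) : ℝ) : ℂ) := by
          rw [← e1]; push_cast; ring
        have f2 : ((((n k : ℝ)⁻¹ * ∑ j, s k j ^ 2) / 2 : ℝ) : ℂ)
            = (m k : ℂ) * ((c k ^ 2 * ((n k : ℝ)⁻¹ * ∑ j, s k j ^ 2) / 2 : ℝ) : ℂ) := by
          have : ((n k : ℝ)⁻¹ * ∑ j, s k j ^ 2) / 2
              = (m k : ℝ) * (c k ^ 2 * ((n k : ℝ)⁻¹ * ∑ j, s k j ^ 2) / 2) := by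
            calc ((n k : ℝ)⁻¹ * ∑ j, s k j ^ 2) / 2
                = 1 * (((n k : ℝ)⁻¹ * ∑ j, s k j ^ 2) / 2) := (one_mul _).symm
              _ = _ := by rw [← e2]; ring
          rw [this, Complex.ofReal_mul, Complex.ofReal_natCast]
        rw [f1, f2]
        ring
      rw [e, norm_mul, Complex.norm_natCast]
      calc (m k : ℝ) * _ ≤ m k * (4 * c k ^ 3 * ((n k : ℝ)⁻¹ * ∑ j, |s k j| ^ 3)) := by gcongr
        _ = 4 * (m k * c k ^ 3) * ((n k : ℝ)⁻¹ * ∑ j, |s k j| ^ 3) := by ring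
        _ = _ := by rw [e3]
    simpa using hB.add hA
  have := tendsto_pow_exp_neg (by positivity : 0 ≤ q / 2)
    (fun k => norm_avg_exp_le_one (fun j => c k * s k j)) hm hmain
  rw [charFun_statLaw hS]
  have e : (-(((q / 2 : ℝ)) : ℂ)) = -((q : ℂ) / 2) := by push_cast; ring
  rw [e] at this
  refine this.congr fun k => ?_
  rw [charFun_map_resample]

end Resampling

end GaussWass

namespace GaussWass

open scoped Matrix.Norms.L2Operator

/-! ### Quadratic expansion of the squared distance -/

section QuadraticExpansion

variable {d : ℕ}

/-- The squared distance to `N(μ, S)` as a function of mean and covariance. -/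
noncomputable def gwAt (μ : Vec d) (S : Mat d) (p : Vec d × SymMat d) : ℝ :=
  wasserstein 2 (multivariateGaussian p.1 (p.2 : Mat d)) (multivariateGaussian μ S) ^ 2

theorem gwAt_eventuallyEq (μ : Vec d) (S : SymMat d) (hS : (S : Mat d).PosDef) :
    gwAt μ (S : Mat d) =ᶠ[𝓝 (μ, S)] PhiOne μ (S : Mat d) := by
  have h1 : Tendsto (fun p : Vec d × SymMat d => (p.2 : Mat d)) (𝓝 (μ, S)) (𝓝 (S : Mat d)) :=
    (continuous_subtype_val.comp continuous_snd).tendsto _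
  filter_upwards [h1.eventually (eventually_posDef hS)] with p hp
  exact wasserstein_two_sq_multivariateGaussian _ _ (hp (SymMat.isHermitian _)) hS

theorem phiOneTwiceDifferentiableAt (ν : Vec d) {B : Mat d} (hB : B.PosDef) (μ : Vec d)
    (S : SymMat d) (hS : (S : Mat d).PosDef) : PhiOneTwiceDifferentiableAt ν B μ S :=
  twiceDifferentiableAt_of_contDiffAt (contDiffAt_phiOne ν hB μ S hS)

theorem PhiOne_self (μ : Vec d) (S : SymMat d) (hS : (S : Mat d).PosDef) :
    PhiOne μ (S : Mat d) (μ, S) = 0 := by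
  have hS0 : (0 : Mat d) ≤ S := hS.posSemidef.nonneg
  have h : CFC.sqrt (S : Mat d) * S * CFC.sqrt (S : Mat d) = S * S := by
    have hRR := CFC.sqrt_mul_sqrt_self (S : Mat d) hS0
    conv_rhs => rw [← hRR]
    nth_rewrite 2 [← hRR]
    simp only [mul_assoc]
  simp only [PhiOne, Phi, sub_self, norm_zero]
  rw [h, CFC.sqrt_mul_self (S : Mat d) hS0]
  ring

/-- No derivative is computed: near `(μ, S)` the functional is a squared distance, so its zero at
`(μ, S)` is a local minimum. -/
theorem fderiv_PhiOne_self (μ : Vec d) (S : SymMat d) (hS : (S : Mat d).PosDef) :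
    fderiv ℝ (PhiOne μ (S : Mat d)) (μ, S) = 0 := by
  refine IsLocalMin.fderiv_eq_zero ?_
  filter_upwards [gwAt_eventuallyEq μ S hS] with p hp
  rw [PhiOne_self μ S hS, ← hp]
  exact sq_nonneg _

theorem isLittleO_gwAt (μ : Vec d) (S : SymMat d) (hS : (S : Mat d).PosDef) :
    (fun h => gwAt μ (S : Mat d) ((μ, S) + h) - 1 / 2 * D2PhiOne μ (S : Mat d) μ S h)
      =o[𝓝 0] fun h => ‖h‖ ^ 2 := by
  have h := isLittleO_sub_half_fderiv_fderiv (contDiffAt_phiOne μ hS μ S hS)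
    (fderiv_PhiOne_self μ S hS)
  refine h.congr' ?_ EventuallyEq.rfl
  have ht : Tendsto (fun h : Vec d × SymMat d => (μ, S) + h) (𝓝 0) (𝓝 (μ, S)) := by
    have := (continuous_const_add ((μ, S) : Vec d × SymMat d)).tendsto 0
    rwa [add_zero] at this
  filter_upwards [ht.eventually (gwAt_eventuallyEq μ S hS)] with h hh
  rw [hh, PhiOne_self μ S hS, sub_zero, D2PhiOne]

/-- The second order delta method with moving arguments. The filter is general because it serves
both along the data (`atTop`) and jointly with a free statistic (`atTop ×ˢ 𝓝 v`). -/
theorem tendsto_sq_mul_of_isLittleO {E ι : Type*} [NormedAddCommGroup E] [NormedSpace ℝ E]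
    {F q : E → ℝ} (hF : (fun h => F h - q h) =o[𝓝 0] fun h => ‖h‖ ^ 2) (hq : Continuous q)
    (hq2 : ∀ (c : ℝ) h, q (c • h) = c ^ 2 * q h) {l : Filter ι} {s : ι → ℝ}
    (hs : Tendsto s l atTop) {h : ι → E} {h₀ : E} (hh : Tendsto h l (𝓝 h₀)) :
    Tendsto (fun i => s i ^ 2 * F ((s i)⁻¹ • h i)) l (𝓝 (q h₀)) := by
  have hsmall : Tendsto (fun i => (s i)⁻¹ • h i) l (𝓝 0) := by
    simpa using (tendsto_inv_atTop_zero.comp hs).smul hh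
  have h1 : (fun i => s i ^ 2 * (F ((s i)⁻¹ • h i) - q ((s i)⁻¹ • h i)))
      =o[l] fun i => s i ^ 2 * ‖(s i)⁻¹ • h i‖ ^ 2 :=
    (Asymptotics.isBigO_refl _ l).mul_isLittleO (hF.comp_tendsto hsmall)
  have h2 : (fun i => s i ^ 2 * ‖(s i)⁻¹ • h i‖ ^ 2) =ᶠ[l] fun i => ‖h i‖ ^ 2 := by
    filter_upwards [hs.eventually_gt_atTop 0] with i hi
    rw [norm_smul, norm_inv, Real.norm_of_nonneg hi.le]
    field_simp
  have h3 : (fun i => ‖h i‖ ^ 2) =O[l] fun _ => (1 : ℝ) := (hh.norm.pow 2).isBigO_one ℝ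
  have h4 := (Asymptotics.isLittleO_one_iff ℝ).1 ((h1.congr' EventuallyEq.rfl h2).trans_isBigO h3)
  have h5 := h4.add ((hq.tendsto h₀).comp hh)
  rw [zero_add] at h5
  refine h5.congr' ?_
  filter_upwards [hs.eventually_gt_atTop 0] with i hi
  rw [Function.comp_apply, hq2]
  field_simp
  ring

end QuadraticExpansion

/-! ### Empirical mean and covariance in terms of the statistic -/

section Displacement

variable {d : ℕ}

/-- The vector part of the statistic. -/
def vecPart (v : StatSpace d) : Vec d := WithLp.toLp 2 fun i => v (Sum.inl i)

/-- The matrix part of the statistic. -/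
def matPart (v : StatSpace d) : SymMat d :=
  ⟨symOf fun p => v (Sum.inr p), isSelfAdjoint_symOf _⟩

/-- The matrix `u uᵗ`, where `u` is the vector part of the statistic. -/
def outerPart (v : StatSpace d) : SymMat d :=
  ⟨Matrix.of fun i j => v (Sum.inl i) * v (Sum.inl j), by
    ext i j; simp [Matrix.star_apply, mul_comm]⟩

theorem continuous_vecPart : Continuous (vecPart : StatSpace d → Vec d) := by
  unfold vecPart; fun_prop

theorem continuous_matPart : Continuous (matPart : StatSpace d → SymMat d) :=
  Continuous.subtype_mk (continuous_matrix fun i j => by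
    simp only [symOf, of_apply]; fun_prop) _

theorem continuous_outerPart : Continuous (outerPart : StatSpace d → SymMat d) :=
  Continuous.subtype_mk (continuous_matrix fun i j => by
    simp only [of_apply]; fun_prop) _

/-- The scaled displacement of mean and covariance as a function of the scaled statistic. -/
def disp (S : SymMat d) (c : ℝ × ℝ × ℝ) (v : StatSpace d) : Vec d × SymMat d :=
  (vecPart v, c.1 • (matPart v - c.2.1 • outerPart v) + c.2.2 • S)

theorem continuous_disp (S : SymMat d) :
    Continuous fun p : (ℝ × ℝ × ℝ) × StatSpace d => disp S p.1 p.2 := by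
  have h1 := continuous_vecPart (d := d)
  have h2 := continuous_matPart (d := d)
  have h3 := continuous_outerPart (d := d)
  unfold disp
  fun_prop

theorem disp_noiseStat (S : SymMat d) (gw : Vec d × (Fin d × Fin d → ℝ)) :
    disp S (1, 0, 0) (noiseStat (S : Mat d) gw) = (gw.1, rootConj (S : Mat d) gw.2) := by
  have h : matPart (noiseStat (S : Mat d) gw) = rootConj (S : Mat d) gw.2 := by
    ext i j
    simp only [matPart, symOf, of_apply, noiseStat_inr]
    have hs : (rootConj (S : Mat d) gw.2 : Mat d) j i = (rootConj (S : Mat d) gw.2 : Mat d) i j := by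
      simpa using (SymMat.isHermitian (rootConj (S : Mat d) gw.2)).apply i j
    rcases le_total i j with hij | hij
    · rw [min_eq_left hij, max_eq_right hij]
    · rw [min_eq_right hij, max_eq_left hij, hs]
  simp only [disp, one_smul, zero_smul, sub_zero, add_zero, h]
  rfl

theorem disp_zero (S : SymMat d) : disp S (1, 0, 0) 0 = 0 := by
  ext i
  · simp [disp, vecPart]
  · simp [disp, matPart, symOf]

/-- The coefficients of `disp` for a sample of size `n` and scaling by `s`. -/
noncomputable def dispCoeff (n : ℕ) (s : ℝ) : ℝ × ℝ × ℝ :=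
  ((n : ℝ) / ((n : ℝ) - 1), s⁻¹, s / ((n : ℝ) - 1))

theorem sampleMean_eq (μ : Vec d) (S : SymMat d) {n : ℕ} (hn : 2 ≤ n) {s : ℝ} (hs : s ≠ 0)
    (x : Fin n → Vec d) :
    ((μ, S) + s⁻¹ • disp S (dispCoeff n s) (s • statAvg μ (S : Mat d) x)).1 = sampleMean x := by
  have hn0 : (n : ℝ) ≠ 0 := by positivity
  ext i
  simp [disp, vecPart, statAvg, sampleMean, Finset.sum_sub_distrib]
  field_simp
  ring

/-- An exact identity: centring at the sample mean subtracts the outer product of the averaged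
deviations, and the divisor `n - 1` leaves the term `S / (n - 1)`. The scale `s` is independent of
`n`, so that resample and full sample can both be scaled by `√m`. -/
theorem sampleCov_eq (μ : Vec d) (S : SymMat d) {n : ℕ} (hn : 2 ≤ n) {s : ℝ} (hs : s ≠ 0)
    (x : Fin n → Vec d) :
    (((μ, S) + s⁻¹ • disp S (dispCoeff n s) (s • statAvg μ (S : Mat d) x)).2 : Mat d)
      = sampleCov x := by
  have hn0 : (n : ℝ) ≠ 0 := by positivity
  have hn1 : (n : ℝ) - 1 ≠ 0 := by
    have : (2 : ℝ) ≤ n := by exact_mod_cast hn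
    linarith
  ext i j
  have hsym : ∀ v : Vec d, v (min i j) * v (max i j) = v i * v j := fun v => by
    rcases le_total i j with h | h
    · rw [min_eq_left h, max_eq_right h]
    · rw [min_eq_right h, max_eq_left h, mul_comm]
  have hsymS : (S : Mat d) (min i j) (max i j) = (S : Mat d) i j := by
    rcases le_total i j with h | h
    · rw [min_eq_left h, max_eq_right h]
    · rw [min_eq_right h, max_eq_left h]
      simpa using (SymMat.isHermitian S).apply i j
  have hmean : ∀ l, sampleMean x l - μ l = (n : ℝ)⁻¹ * ∑ k, (x k - μ) l := fun l => by
    simp [sampleMean, Finset.sum_sub_distrib]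
    field_simp
  have hcov : sampleCov x i j = ((n : ℝ) - 1)⁻¹ * (∑ k, (x k - μ) i * (x k - μ) j
      - (n : ℝ)⁻¹ * (∑ k, (x k - μ) i) * ∑ k, (x k - μ) j) := by
    have e : ∀ k, (x k - sampleMean x) i * (x k - sampleMean x) j
        = (x k - μ) i * (x k - μ) j - (sampleMean x i - μ i) * (x k - μ) j
          - (x k - μ) i * (sampleMean x j - μ j)
          + (sampleMean x i - μ i) * (sampleMean x j - μ j) := fun k => by
      simp only [PiLp.sub_apply]; ring
    simp only [sampleCov, Matrix.smul_apply, Matrix.sum_apply, of_apply, smul_eq_mul, e]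
    congr 1
    rw [Finset.sum_add_distrib, Finset.sum_sub_distrib, Finset.sum_sub_distrib, ← Finset.mul_sum,
      ← Finset.sum_mul, hmean, hmean]
    simp only [Finset.sum_const, Finset.card_univ, Fintype.card_fin, nsmul_eq_mul]
    field_simp
    ring
  have hsum : ∑ k, stat μ (S : Mat d) (x k) (Sum.inr (min i j, max i j))
      = ∑ k, (x k - μ) i * (x k - μ) j - n * (S : Mat d) i j := by
    simp only [stat_inr, hsym, hsymS, Finset.sum_sub_distrib]
    simp
  have hW : (matPart (s • statAvg μ (S : Mat d) x) : Mat d) i j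
      = s * ((n : ℝ)⁻¹ * (∑ k, (x k - μ) i * (x k - μ) j - n * (S : Mat d) i j)) := by
    rw [← hsum]
    simp [matPart, symOf, statAvg]
  have hO : (outerPart (s • statAvg μ (S : Mat d) x) : Mat d) i j
      = s * ((n : ℝ)⁻¹ * ∑ k, (x k - μ) i) * (s * ((n : ℝ)⁻¹ * ∑ k, (x k - μ) j)) := by
    simp [outerPart, statAvg]
  have : (((μ, S) + s⁻¹ • disp S (dispCoeff n s) (s • statAvg μ (S : Mat d) x)).2 : Mat d) i j
      = (S : Mat d) i j + s⁻¹ * ((n : ℝ) / ((n : ℝ) - 1)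
          * ((matPart (s • statAvg μ (S : Mat d) x) : Mat d) i j
            - s⁻¹ * (outerPart (s • statAvg μ (S : Mat d) x) : Mat d) i j)
          + s / ((n : ℝ) - 1) * (S : Mat d) i j) := by
    simp [disp, dispCoeff]
    ring
  rw [this, hW, hO, hcov]
  field_simp
  ring

theorem gwEstimator_eq_gwAt (μ : Vec d) (S : SymMat d) {n : ℕ} (hn : 2 ≤ n) {s : ℝ} (hs : s ≠ 0)
    (x : Fin n → Vec d) :
    gwEstimator x (multivariateGaussian μ (S : Mat d)) = gwAt μ (S : Mat d)
      ((μ, S) + s⁻¹ • disp S (dispCoeff n s) (s • statAvg μ (S : Mat d) x)) := by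
  rw [gwAt, sampleMean_eq μ S hn hs, sampleCov_eq μ S hn hs, gwEstimator]

theorem tendsto_dispCoeff {n : ℕ → ℕ} {s : ℕ → ℝ} (hn : Tendsto n atTop atTop)
    (hs : Tendsto s atTop atTop) (hns : Tendsto (fun k => s k / (n k : ℝ)) atTop (𝓝 0)) :
    Tendsto (fun k => dispCoeff (n k) (s k)) atTop (𝓝 (1, 0, 0)) := by
  have hnr : Tendsto (fun k => (n k : ℝ)) atTop atTop := tendsto_natCast_atTop_atTop.comp hn
  have h1 : Tendsto (fun k => (n k : ℝ) / ((n k : ℝ) - 1)) atTop (𝓝 1) := by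
    have h := (tendsto_inv_atTop_zero.comp hnr).const_sub 1
    have h' := h.inv₀ (by norm_num)
    simp only [sub_zero, inv_one] at h'
    refine h'.congr' ?_
    filter_upwards [hnr.eventually_gt_atTop 1] with k hk
    have : (n k : ℝ) - 1 ≠ 0 := by linarith
    simp only [Function.comp_apply]
    field_simp
  refine h1.prodMk_nhds ((tendsto_inv_atTop_zero.comp hs).prodMk_nhds ?_)
  have := hns.mul h1
  rw [zero_mul] at this
  refine this.congr' ?_
  filter_upwards [hnr.eventually_gt_atTop 1] with k hk
  field_simp

theorem limitLaw_eq_map (μ : Vec d) (S : SymMat d) :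
    limitLaw μ S = (statLaw (S : Mat d)).map
      fun v => 1 / 2 * D2PhiOne μ (S : Mat d) μ S (disp S (1, 0, 0) v) := by
  have hc : Continuous fun v => 1 / 2 * D2PhiOne μ (S : Mat d) μ S (disp S (1, 0, 0) v) := by
    have h := (continuous_disp S).comp (Continuous.prodMk_right (1, 0, 0))
    simp only [Function.comp_def] at h
    unfold D2PhiOne
    fun_prop
  rw [statLaw, Measure.map_map hc.measurable (by fun_prop), limitLaw]
  simp only [Function.comp_def, disp_noiseStat]

end Displacement

/-! ### Convergence of the bootstrap law along deterministic samples -/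

section Deterministic

variable {d : ℕ}

theorem tendsto_levyProkhorovDist_bootstrapLaw (μ : Vec d) (S : SymMat d) (hS : (S : Mat d).PosDef)
    {n m : ℕ → ℕ} (hn2 : ∀ k, 2 ≤ n k) (hm2 : ∀ k, 2 ≤ m k) (hn : Tendsto n atTop atTop)
    (hm : Tendsto m atTop atTop) (hmn : Tendsto (fun k => (m k : ℝ) / (n k : ℝ)) atTop (𝓝 0))
    (x : ∀ k, Fin (n k) → Vec d)
    (h1 : Tendsto (fun k => √(m k) • statAvg μ (S : Mat d) (x k)) atTop (𝓝 0))
    (h2 : ∀ α β, Tendsto (fun k => ((n k : ℝ)⁻¹ *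
      ∑ j, stat μ (S : Mat d) (x k j) α * stat μ (S : Mat d) (x k j) β))
      atTop (𝓝 (statCov (S : Mat d) α β)))
    {K : ℝ} (h3 : Tendsto (fun k => ((n k : ℝ)⁻¹ * ∑ j, ‖stat μ (S : Mat d) (x k j)‖ ^ 3))
      atTop (𝓝 K)) :
    Tendsto (fun k => levyProkhorovDist
      (bootstrapLaw (x k) (multivariateGaussian μ (S : Mat d)) (m k)) (limitLaw μ S))
      atTop (𝓝 0) := by
  have hnz : ∀ k, NeZero (n k) := fun k => ⟨by have := hn2 k; omega⟩
  have hprob : ∀ k, IsProbabilityMeasure (resampleLaw (n k) (m k)) := fun k => inferInstance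
  let F : Vec d × SymMat d → ℝ := fun h => gwAt μ (S : Mat d) ((μ, S) + h)
  let q : Vec d × SymMat d → ℝ := fun h => 1 / 2 * D2PhiOne μ (S : Mat d) μ S h
  have hFq : (fun h => F h - q h) =o[𝓝 0] fun h => ‖h‖ ^ 2 := isLittleO_gwAt μ S hS
  have hq : Continuous q := by
    simp only [q, D2PhiOne]; fun_prop
  have hq2 : ∀ (c : ℝ) h, q (c • h) = c ^ 2 * q h := fun c h => by
    simp [q, D2PhiOne]; ring
  have hq0 : q 0 = 0 := by simp [q, D2PhiOne]
  let s : ℕ → ℝ := fun k => √(m k)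
  have hmr : Tendsto (fun k => (m k : ℝ)) atTop atTop := tendsto_natCast_atTop_atTop.comp hm
  have hs : Tendsto s atTop atTop := Real.tendsto_sqrt_atTop.comp hmr
  have hs0 : ∀ k, s k ≠ 0 := fun k => by
    have : (0 : ℝ) < m k := by exact_mod_cast (by have := hm2 k; omega)
    exact (Real.sqrt_pos.2 this).ne'
  have hss : ∀ k, s k ^ 2 = m k := fun k => Real.sq_sqrt (Nat.cast_nonneg _)
  have hsle : ∀ k, s k ≤ m k := fun k => by
    have h2k : (2 : ℝ) ≤ m k := by exact_mod_cast hm2 k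
    exact Real.sqrt_le_iff.2 ⟨by linarith, by nlinarith⟩
  have hcm : Tendsto (fun k => dispCoeff (m k) (s k)) atTop (𝓝 (1, 0, 0)) := by
    refine tendsto_dispCoeff hm hs ((tendsto_inv_atTop_zero.comp hs).congr fun k => ?_)
    have := hs0 k
    rw [← hss k, Function.comp_apply]
    field_simp
  have hcn : Tendsto (fun k => dispCoeff (n k) (s k)) atTop (𝓝 (1, 0, 0)) := by
    refine tendsto_dispCoeff hn hs (squeeze_zero (fun k => ?_) (fun k => ?_) hmn)
    · exact div_nonneg (Real.sqrt_nonneg _) (Nat.cast_nonneg _)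
    · exact div_le_div_of_nonneg_right (hsle k) (Nat.cast_nonneg _)
  -- This is `m` times the estimator of the full sample. At scale `√m` its displacement tends to
  -- `0`, hence so does `r`.
  let r : ℕ → ℝ := fun k => s k ^ 2 *
    F ((s k)⁻¹ • disp S (dispCoeff (n k) (s k)) (s k • statAvg μ (S : Mat d) (x k)))
  have hr : Tendsto r atTop (𝓝 0) := by
    have hd := ((continuous_disp S).tendsto ((1, 0, 0), 0)).comp (hcn.prodMk_nhds h1)
    have := tendsto_sq_mul_of_isLittleO hFq hq hq2 hs hd
    rwa [disp_zero, hq0] at this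
  let h : ℕ → StatSpace d → ℝ := fun k v =>
    s k ^ 2 * F ((s k)⁻¹ • disp S (dispCoeff (m k) (s k)) v) - r k
  -- Joint convergence in index and statistic, as the extended continuous mapping theorem demands.
  have hconv : ∀ v, Tendsto (fun p : ℕ × StatSpace d => h p.1 p.2) (atTop ×ˢ 𝓝 v)
      (𝓝 (q (disp S (1, 0, 0) v))) := by
    intro v
    have hd := ((continuous_disp S).tendsto ((1, 0, 0), v)).comp
      ((hcm.comp (tendsto_fst (f := atTop) (g := 𝓝 v))).prodMk_nhds
        (tendsto_snd (f := (atTop : Filter ℕ)) (g := 𝓝 v)))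
    have h5 := tendsto_sq_mul_of_isLittleO hFq hq hq2 (hs.comp tendsto_fst) hd
    have := h5.sub (hr.comp (tendsto_fst (f := atTop) (g := 𝓝 v)))
    rwa [sub_zero] at this
  have hYZ : ∀ k (J : Fin (m k) → Fin (n k)),
      (m k : ℝ) * (gwEstimator (fun i => x k (J i)) (multivariateGaussian μ (S : Mat d))
        - gwEstimator (x k) (multivariateGaussian μ (S : Mat d)))
      = h k (√(m k) • statAvg μ (S : Mat d) fun i => x k (J i)) := by
    intro k J
    rw [gwEstimator_eq_gwAt μ S (hm2 k) (hs0 k), gwEstimator_eq_gwAt μ S (hn2 k) (hs0 k), mul_sub]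
    simp only [h, r, F, hss]
    rfl
  let ν : ℕ → ProbabilityMeasure (StatSpace d) := fun k =>
    ⟨(resampleLaw (n k) (m k)).map fun J => √(m k) • statAvg μ (S : Mat d) fun i => x k (J i),
      Measure.isProbabilityMeasure_map Measurable.of_discrete.aemeasurable⟩
  let ν' : ProbabilityMeasure (StatSpace d) := ⟨statLaw (S : Mat d), inferInstance⟩
  have hν : Tendsto ν atTop (𝓝 ν') := ProbabilityMeasure.tendsto_of_tendsto_charFun fun t =>
    tendsto_charFun_map_resample μ hS.posSemidef hm x h1 h2 h3 t
  let ρ : ℕ → ProbabilityMeasure ℝ := fun k =>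
    ⟨bootstrapLaw (x k) (multivariateGaussian μ (S : Mat d)) (m k),
      Measure.isProbabilityMeasure_map Measurable.of_discrete.aemeasurable⟩
  have hcont : Continuous fun v => q (disp S (1, 0, 0) v) :=
    hq.comp ((continuous_disp S).comp (Continuous.prodMk_right (1, 0, 0)))
  let ρ' : ProbabilityMeasure ℝ := ⟨limitLaw μ S, by
    rw [limitLaw_eq_map]
    exact Measure.isProbabilityMeasure_map hcont.measurable.aemeasurable⟩
  exact tendsto_levyProkhorovDist (ρ := ρ) (ρ' := ρ')
    (tendsto_map_of_tendsto_prod hν (P := fun k => resampleLaw (n k) (m k))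
      (fun k => Measurable.of_discrete) (fun k => rfl) (fun k => Measurable.of_discrete) hYZ
      hcont.measurable hconv (fun k => rfl) (limitLaw_eq_map μ S))

end Deterministic

end GaussWass

namespace GaussWass

/-! ### Convergence of the bootstrap law in probability -/

section InProbability

variable {d : ℕ}

theorem continuous_stat_apply (μ : Vec d) (S : Mat d) (α : StatIdx d) :
    Continuous fun x => stat μ S x α := by
  rcases α with i | p
  · simp only [stat_inl]; fun_prop
  · simp only [stat_inr]; fun_prop

theorem continuous_stat (μ : Vec d) (S : Mat d) : Continuous (stat μ S) :=
  (PiLp.continuous_toLp 2 _).comp (continuous_pi fun α => continuous_stat_apply μ S α)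

theorem tendsto_zero_of_abs_lt {a : ℕ → ℝ} (h : ∀ k, |a k| < 1 / ((k : ℝ) + 1)) :
    Tendsto a atTop (𝓝 0) :=
  squeeze_zero_norm (fun k => (h k).le) tendsto_one_div_add_atTop_nhds_zero_nat

/-- If no `δ` and `N` worked, choosing `δ = 1 / (k + 1)` would produce a sequence of samples
contradicting the deterministic theorem. The uniformity removes all randomness of the data except
finitely many deviation events. -/
theorem exists_levyProkhorovDist_bootstrapLaw_lt (μ : Vec d) (S : SymMat d)
    (hS : (S : Mat d).PosDef) {m : ℕ → ℕ} (hm : Tendsto m atTop atTop)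
    (hmn : Tendsto (fun n : ℕ => (m n : ℝ) / (n : ℝ)) atTop (𝓝 0)) (K : ℝ) {ε : ℝ} (hε : 0 < ε) :
    ∃ δ > 0, ∃ N : ℕ, ∀ n ≥ N, ∀ x : Fin n → Vec d,
      (∀ α, |√(m n) * ((n : ℝ)⁻¹ * ∑ j, stat μ (S : Mat d) (x j) α)| < δ) →
      (∀ α β, |(n : ℝ)⁻¹ * ∑ j, stat μ (S : Mat d) (x j) α * stat μ (S : Mat d) (x j) β
        - statCov (S : Mat d) α β| < δ) →
      |(n : ℝ)⁻¹ * ∑ j, ‖stat μ (S : Mat d) (x j)‖ ^ 3 - K| < δ →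
      levyProkhorovDist (bootstrapLaw x (multivariateGaussian μ (S : Mat d)) (m n))
        (limitLaw μ S) < ε := by
  by_contra! hcon
  obtain ⟨N₀, hN₀⟩ := eventually_atTop.1 (hm.eventually_ge_atTop 2)
  have hk : ∀ k : ℕ, (0 : ℝ) < 1 / ((k : ℝ) + 1) := fun k => by positivity
  -- The threshold `k + N₀ + 2` forces `n k → ∞` and keeps both `n k` and `m (n k)` at least `2`, as
  -- the unbiased covariance needs.
  choose n hn x h1 h2 h3 h4 using fun k : ℕ => hcon (1 / ((k : ℝ) + 1)) (hk k) (k + N₀ + 2)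
  have hnt : Tendsto n atTop atTop :=
    tendsto_atTop_mono (fun k => by have := hn k; rw [id]; omega) tendsto_id
  have hlim := tendsto_levyProkhorovDist_bootstrapLaw μ S hS (m := fun k => m (n k))
    (fun k => by have := hn k; omega) (fun k => hN₀ _ (by have := hn k; omega)) hnt
    (hm.comp hnt) (hmn.comp hnt) x ?_ (fun α β => ?_) (K := K) ?_
  · obtain ⟨k, hk⟩ := (hlim.eventually (gt_mem_nhds hε)).exists
    exact (h4 k).not_gt hk
  · have hp := tendsto_pi_nhds.2 fun α => tendsto_zero_of_abs_lt fun k => h1 k α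
    refine ((PiLp.continuous_toLp 2 fun _ : StatIdx d => ℝ).tendsto _ |>.comp hp).congr fun k => ?_
    ext α
    simp [statAvg]
  · exact tendsto_sub_nhds_zero_iff.1 (tendsto_zero_of_abs_lt fun k => h2 k α β)
  · exact tendsto_sub_nhds_zero_iff.1 (tendsto_zero_of_abs_lt h3)

/-! ### Deviation probabilities for empirical averages. -/

variable {Ω : Type*} [MeasurableSpace Ω] {P : Measure Ω}
  {X : ℕ → Ω → Vec d} {ν : Measure (Vec d)}

theorem identDistrib_comp (hX : ∀ i, HasLaw (X i) ν P) {f : Vec d → ℝ} (hf : Measurable f)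
    (i : ℕ) : IdentDistrib (f ∘ X i) (f ∘ X 0) P P :=
  ((hX i).identDistrib (hX 0)).comp hf

theorem integral_comp_hasLaw (hX : ∀ i, HasLaw (X i) ν P) {f : Vec d → ℝ} (hf : Measurable f)
    (i : ℕ) : ∫ ω, f (X i ω) ∂P = ∫ x, f x ∂ν := by
  rw [← (hX i).map_eq, integral_map (hX i).aemeasurable hf.aestronglyMeasurable]

theorem memLp_comp_hasLaw (hX : ∀ i, HasLaw (X i) ν P) {f : Vec d → ℝ}
    {p : ℝ≥0∞} (hfi : MemLp f p ν) (i : ℕ) : MemLp (f ∘ X i) p P := by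
  rw [← (hX i).map_eq] at hfi
  exact hfi.comp_of_map (hX i).aemeasurable

variable [IsProbabilityMeasure P]

theorem tendsto_measure_le_abs_avg_sub (hX : ∀ i, HasLaw (X i) ν P) (hindep : iIndepFun X P)
    {f : Vec d → ℝ} (hf : Measurable f) (hfi : Integrable f ν) {δ : ℝ} (hδ : 0 < δ) :
    Tendsto (fun n : ℕ => P {ω | δ ≤ |(n : ℝ)⁻¹ * ∑ j : Fin n, f (X j ω) - ∫ x, f x ∂ν|})
      atTop (𝓝 0) := by
  have hmem := fun i => memLp_comp_hasLaw hX (memLp_one_iff_integrable.2 hfi) i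
  have h := strong_law_ae (μ := P) (fun i => f ∘ X i) (memLp_one_iff_integrable.1 (hmem 0))
    (fun i j hij => (hindep.comp (fun _ => f) fun _ => hf).indepFun hij)
    (identDistrib_comp hX hf)
  have hmeas := tendstoInMeasure_of_tendsto_ae (μ := P) (g := fun _ => ∫ ω, f (X 0 ω) ∂P)
    (f := fun (n : ℕ) ω => (n : ℝ)⁻¹ • ∑ i ∈ Finset.range n, f (X i ω))
    (fun n => (Finset.aestronglyMeasurable_fun_sum (f := fun i ω => f (X i ω)) _ fun i _ =>
      (hmem i).aestronglyMeasurable).const_mul _) h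
  rw [integral_comp_hasLaw hX hf, tendstoInMeasure_iff_norm] at hmeas
  refine (hmeas δ hδ).congr fun n => ?_
  congr 1
  ext ω
  simp only [smul_eq_mul, Real.norm_eq_abs, Set.mem_ofPred_eq,
    Fin.sum_univ_eq_sum_range fun i => f (X i ω)]

/-- Chebyshev's inequality: the scaled average has mean `0` and variance `(m / n) V`. -/
theorem tendsto_measure_le_abs_sqrt_mul_avg (hX : ∀ i, HasLaw (X i) ν P) (hindep : iIndepFun X P)
    {m : ℕ → ℕ} (hmn : Tendsto (fun n : ℕ => (m n : ℝ) / (n : ℝ)) atTop (𝓝 0))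
    {f : Vec d → ℝ} (hf : Measurable f) (hfi : MemLp f 2 ν) (hf0 : ∫ x, f x ∂ν = 0)
    {δ : ℝ} (hδ : 0 < δ) :
    Tendsto (fun n : ℕ => P {ω | δ ≤ |√(m n) * ((n : ℝ)⁻¹ * ∑ j : Fin n, f (X j ω))|})
      atTop (𝓝 0) := by
  have hmem := fun i => memLp_comp_hasLaw hX hfi i
  set V := Var[f ∘ X 0; P] with hV
  have hbound : ∀ n : ℕ, P {ω | δ ≤ |√(m n) * ((n : ℝ)⁻¹ * ∑ j : Fin n, f (X j ω))|}
      ≤ ENNReal.ofReal ((m n : ℝ) / n * V / δ ^ 2) := by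
    intro n
    let Y : Ω → ℝ := fun ω => (√(m n) * (n : ℝ)⁻¹) * (∑ i ∈ Finset.range n, f ∘ X i) ω
    have hsum : MemLp (∑ i ∈ Finset.range n, f ∘ X i) 2 P := memLp_finsetSum' _ fun i _ => hmem i
    have hY : MemLp Y 2 P := hsum.const_mul _
    have hmean : ∫ ω, Y ω ∂P = 0 := by
      simp only [Y, integral_const_mul, Finset.sum_apply, Function.comp_apply]
      rw [integral_finsetSum (f := fun i ω => f (X i ω)) _ fun i _ =>
        (hmem i).integrable (by norm_num)]
      simp [integral_comp_hasLaw hX hf, hf0]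
    have hvar : Var[Y; P] = (m n : ℝ) / n * V := by
      simp only [Y]
      rw [variance_const_mul, IndepFun.variance_sum (fun i _ => hmem i) fun i _ j _ hij =>
        (hindep.comp (fun _ => f) fun _ => hf).indepFun hij,
        Finset.sum_congr rfl fun i _ => (identDistrib_comp hX hf i).variance_eq, ← hV,
        Finset.sum_const, Finset.card_range, nsmul_eq_mul, mul_pow, Real.sq_sqrt (by positivity)]
      rcases eq_or_ne (n : ℝ) 0 with h | h
      · simp [h]
      · field_simp
    have h := meas_ge_le_variance_div_sq hY hδ
    rw [hvar, hmean] at h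
    refine le_of_eq_of_le ?_ h
    congr 1
    ext ω
    simp only [Y, Set.mem_ofPred_eq, sub_zero, Finset.sum_apply, Function.comp_apply, mul_assoc,
      Fin.sum_univ_eq_sum_range fun i => f (X i ω)]
  have hlim : Tendsto (fun n : ℕ => ENNReal.ofReal ((m n : ℝ) / n * V / δ ^ 2)) atTop (𝓝 0) := by
    have h := ENNReal.tendsto_ofReal ((hmn.mul_const V).div_const (δ ^ 2))
    simpa using h
  exact tendsto_of_tendsto_of_tendsto_of_le_of_le tendsto_const_nhds hlim (fun _ => zero_le)
    hbound

/-- A union bound over finitely many deviation events. Only monotonicity and subadditivity of `P`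
are used, so measurability of the bootstrap distance in `ω` never has to be established. -/
theorem tendsto_measure_le_levyProkhorovDist (μ : Vec d) (S : SymMat d) (hS : (S : Mat d).PosDef)
    (hX : ∀ i, HasLaw (X i) (multivariateGaussian μ (S : Mat d)) P) (hindep : iIndepFun X P)
    {m : ℕ → ℕ} (hm : Tendsto m atTop atTop)
    (hmn : Tendsto (fun n : ℕ => (m n : ℝ) / (n : ℝ)) atTop (𝓝 0)) {ε : ℝ} (hε : 0 < ε) :
    Tendsto (fun n : ℕ => P {ω | ε ≤ levyProkhorovDist
      (bootstrapLaw (fun i : Fin n => X i ω) (multivariateGaussian μ (S : Mat d)) (m n))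
      (limitLaw μ S)}) atTop (𝓝 0) := by
  set ν := multivariateGaussian μ (S : Mat d) with hν
  let Y : Vec d → StatSpace d := stat μ (S : Mat d)
  have hYm : ∀ α, Measurable fun x => Y x α := fun α => (continuous_stat_apply μ _ α).measurable
  have hYn : Measurable fun x => ‖Y x‖ ^ 3 := ((continuous_stat μ (S : Mat d)).norm.pow 3).measurable
  have hY2 : ∀ α, MemLp (fun x => Y x α) 2 ν := fun α => (memLp_stat ν μ _ 2 (by simp)).eval_piLp α
  have hYi : ∀ α β, Integrable (fun x => Y x α * Y x β) ν := fun α β =>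
    (hY2 α).integrable_mul (hY2 β)
  have hY3 : Integrable (fun x => ‖Y x‖ ^ 3) ν := (memLp_stat ν μ _ 3 (by simp)).integrable_norm_pow
    (by norm_num)
  obtain ⟨δ, hδ, N, hN⟩ := exists_levyProkhorovDist_bootstrapLaw_lt μ S hS hm hmn
    (∫ x, ‖Y x‖ ^ 3 ∂ν) hε
  let A : ℕ → StatIdx d → Set Ω := fun n α =>
    {ω | δ ≤ |√(m n) * ((n : ℝ)⁻¹ * ∑ j : Fin n, Y (X j ω) α)|}
  let B : ℕ → StatIdx d × StatIdx d → Set Ω := fun n αβ =>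
    {ω | δ ≤ |(n : ℝ)⁻¹ * ∑ j : Fin n, Y (X j ω) αβ.1 * Y (X j ω) αβ.2
      - ∫ x, Y x αβ.1 * Y x αβ.2 ∂ν|}
  let C : ℕ → Set Ω := fun n =>
    {ω | δ ≤ |(n : ℝ)⁻¹ * ∑ j : Fin n, ‖Y (X j ω)‖ ^ 3 - ∫ x, ‖Y x‖ ^ 3 ∂ν|}
  have hlim : Tendsto (fun n => ∑ α, P (A n α) + ∑ αβ, P (B n αβ) + P (C n)) atTop (𝓝 0) := by
    have hA := tendsto_finsetSum Finset.univ fun α _ => tendsto_measure_le_abs_sqrt_mul_avg hX hindep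
      hmn (hYm α) (hY2 α) (integral_stat μ hS.posSemidef α) hδ
    have hB := tendsto_finsetSum Finset.univ fun (αβ : StatIdx d × StatIdx d) _ =>
      tendsto_measure_le_abs_avg_sub hX hindep ((hYm αβ.1).mul (hYm αβ.2)) (hYi αβ.1 αβ.2) hδ
    have hC := tendsto_measure_le_abs_avg_sub hX hindep hYn hY3 hδ
    have := (hA.add hB).add hC
    simp only [Finset.sum_const_zero, add_zero] at this
    exact this
  refine tendsto_of_tendsto_of_tendsto_of_le_of_le' tendsto_const_nhds hlim
    (Eventually.of_forall fun _ => zero_le) ?_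
  filter_upwards [eventually_ge_atTop N] with n hn
  have hsub : {ω | ε ≤ levyProkhorovDist (bootstrapLaw (fun i : Fin n => X i ω) ν (m n))
      (limitLaw μ S)} ⊆ (⋃ α, A n α) ∪ (⋃ αβ, B n αβ) ∪ C n := by
    intro ω hω
    by_contra hcon
    simp only [Set.mem_union, Set.mem_iUnion, not_or, not_exists, A, B, C, Set.mem_ofPred_eq,
      not_le] at hcon
    obtain ⟨⟨h1, h2⟩, h3⟩ := hcon
    refine (hN n hn (fun i => X i ω) h1 (fun α β => ?_) h3).not_ge hω
    rw [← integral_stat_mul_stat μ hS.posSemidef α β]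
    exact h2 (α, β)
  refine (measure_mono hsub).trans ((measure_union_le _ _).trans ?_)
  gcongr
  refine (measure_union_le _ _).trans ?_
  gcongr <;> exact measure_iUnion_fintype_le _ _

end InProbability

end GaussWass

theorem mainTheorem9 {d : ℕ} (μ : GaussWass.Vec d) (S : GaussWass.SymMat d)
    (hS : (S : GaussWass.Mat d).PosDef)
    {Ω : Type*} [MeasurableSpace Ω] (P : Measure Ω) [IsProbabilityMeasure P]
    (X : ℕ → Ω → GaussWass.Vec d)
    (hX : ∀ i, HasLaw (X i) (multivariateGaussian μ (S : GaussWass.Mat d)) P)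
    (hindep : iIndepFun X P)
    (m : ℕ → ℕ) (hm : Tendsto m atTop atTop)
    (hmn : Tendsto (fun n : ℕ => (m n : ℝ) / (n : ℝ)) atTop (𝓝 0)) :
    GaussWass.PhiOneTwiceDifferentiableAt μ (S : GaussWass.Mat d) μ S ∧
    ∀ ε : ℝ, 0 < ε →
      Tendsto (fun n : ℕ => P {ω | ε ≤ levyProkhorovDist
          (GaussWass.bootstrapLaw (fun i : Fin n => X i ω)
            (multivariateGaussian μ (S : GaussWass.Mat d)) (m n))
          (GaussWass.limitLaw μ S)})
        atTop (𝓝 0) :=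
  ⟨GaussWass.phiOneTwiceDifferentiableAt μ hS μ S hS,
    fun _ hε => GaussWass.tendsto_measure_le_levyProkhorovDist μ S hS hX hindep hm hmn hε⟩
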